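/- Let $a_0=1$, $a_1,a_2,\dots>0$ and $b_1,b_2,\dots\in\mathbb R$, and let $T\ge 1$. For a control $f=(f_0,\dots,f_{T-1})\in\mathbb C^T$ (extended by zero to a sequence $f_t$, $t\ge 0$) let $u^f_{n,t}$ be the solution of $$u_{n,t+1}+u_{n,t-1}-a_nu_{n+1,t}-a_{n-1}u_{n-1,t}-b_nu_{n,t}=0\ (n\ge1,\ t\ge0),\quad u_{n,-1}=u_{n,0}=0\ (n\ge 1),\quad u_{0,t}=f_t .$$ Let $W^T:\mathbb C^T\to\mathbb C^T$, $(W^Tf)_n=u^f_{n,T}$ $(1\le n\le T)$, let $J_T$ be the reversal of coordinates on $\mathbb C^T$, and put $C^T=(W^T)^*W^T$, $C_T=J_TC^TJ_T$, $(f,g)=\sum_k\overline{f_k}g_k$. Let $\mathcal T_0=0$, $\mathcal T_1=1$, $\mathcal T_{k+1}(\lambda)=\lambda\mathcal T_k(\lambda)-\mathcal T_{k-1}(\lambda)$; let $\phi_0=0$, $\phi_1=1$, $a_n\phi_{n+1}+a_{n-1}\phi_{n-1}+b_n\phi_n=\lambda\phi_n$ $(n\ge1)$; and for $h\in\mathbb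 C^T$ let $(Fh)(\lambda)=\sum_{n=1}^Th_n\phi_n(\lambda)$. Put $$B_A^T=\{F(W^TJ_Tf)\ |\ f\in\mathbb C^T\},$$ the set of Fourier images of the states reachable at time $T$. 1. For $f=(f_1,\dots,f_T)\in\mathbb C^T$ one has $F(W^TJ_Tf)=\sum_{k=1}^T\mathcal T_kf_k$. Hence $B_A^T=\{\sum_{k=1}^T\mathcal T_kf_k\ |\ f\in\mathbb C^T\}$. The states $v^f_{\cdot,T}$ of the same system on the sites $1,\dots,T$ with $v_{T+1,t}=0$ coincide with $u^f_{\cdot,T}$, so that their Fourier images form the same set. $B_A^T$ is the set of all polynomials of degree at most $T-1$ with complex coefficients; $\sum_{k=1}^T\mathcal T_kf_k$ has real coefficients if and only if $f$ is real. 2. The map $f\mapsto\sum_{k=1}^T\mathcal T_kf_k$ is injective, and for $F=\sum_k\mathcal T_kf_k$, $G=\sum_k\mathcal T_kg_k$ the formula $[F,G]:=(C_Tf,g)$ defines an inner product on $B_A^T$. With it $B_A^T$ is a de Branges space: there is an entire function $E$ with $|E(z)|>|E(\bar z)|$ for $\operatorname{Im}z>0$ such that $B_A^T$ is the set of entire functions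 $F$ for which $F/E$ and $F^\#/E$, with $F^\#(z)=\overline{F(\bar z)}$, lie in the Hardy space $H_2$ of the upper half-plane (holomorphic functions $h$ there with $\sup_{y>0}\int_{\mathbb R}|h(x+iy)|^2dx<\infty$), and $$[F,G]=\frac1\pi\int_{\mathbb R}\overline{F(x)}G(x)\frac{dx}{|E(x)|^2},\qquad F,G\in B_A^T,$$ the integrals being absolutely convergent. 3. For every $z\in\mathbb C$ the Krein equation $C_Tj_T^z=(\mathcal T_1(z),\dots,\mathcal T_T(z))^*$ (on the right, the column of the complex conjugates) has a unique solution, and $J_z(\lambda)=\sum_{k=1}^T\mathcal T_k(\lambda)(j_T^z)_k$ is the reproducing kernel: $J_z\in B_A^T$, $[J_z,F]=F(z)$ for all $F\in B_A^T$, and $J_z(\lambda)=\dfrac{\overline{E(z)}E(\lambda)-E(\bar z)\overline{E(\bar\lambda)}}{2i(\bar z-\lambda)}$ for $\lambda\ne\bar z$. Moreover $J_z(\lambda)=\sum_{n=1}^T\overline{\phi_n(z)}\,\phi_n(\lambda)$ for all $\lambda$. -/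

import Mathlib

open scoped ComplexConjugate

noncomputable section

/-! ### The semi-infinite and the finite discrete-time dynamical systems -/

/-- The solution of the semi-infinite system with boundary control `f`;
`jacobiWave a b f t n` is the value `u_{n,t}` at time `t` and site `n`:
`u_{n,t+1} + u_{n,t-1} - a_n u_{n+1,t} - a_{n-1} u_{n-1,t} - b_n u_{n,t} = 0` for `n ≥ 1`, `t ≥ 0`,
`u_{n,-1} = u_{n,0} = 0` for `n ≥ 1` and `u_{0,t} = f_t` for `t ≥ 0`.
The second clause is the equation at `t = 0`, where `u_{n,-1} = 0`. -/
def jacobiWave (a b : ℕ → ℝ) (f : ℕ → ℂ) : ℕ → ℕ → ℂ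
  | 0, n => if n = 0 then f 0 else 0
  | 1, n => if n = 0 then f 1 else
      a n * jacobiWave a b f 0 (n + 1) + a (n - 1) * jacobiWave a b f 0 (n - 1)
        + b n * jacobiWave a b f 0 n
  | t + 2, n => if n = 0 then f (t + 2) else
      a n * jacobiWave a b f (t + 1) (n + 1) + a (n - 1) * jacobiWave a b f (t + 1) (n - 1)
        + b n * jacobiWave a b f (t + 1) n - jacobiWave a b f t n

/-- The solution `v_{n,t}` of the system on the sites `1, …, N`: the same equations for
`1 ≤ n ≤ N`, the same initial and boundary data, and `v_{N+1,t} = 0`. (Sites beyond `N + 1` do not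
belong to the system; the value there is set to `0`.) -/
def jacobiWaveFin (a b : ℕ → ℝ) (N : ℕ) (f : ℕ → ℂ) : ℕ → ℕ → ℂ
  | 0, n => if n = 0 then f 0 else 0
  | 1, n => if n = 0 then f 1 else if N < n then 0 else
      a n * jacobiWaveFin a b N f 0 (n + 1) + a (n - 1) * jacobiWaveFin a b N f 0 (n - 1)
        + b n * jacobiWaveFin a b N f 0 n
  | t + 2, n => if n = 0 then f (t + 2) else if N < n then 0 else
      a n * jacobiWaveFin a b N f (t + 1) (n + 1)
        + a (n - 1) * jacobiWaveFin a b N f (t + 1) (n - 1)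
        + b n * jacobiWaveFin a b N f (t + 1) n - jacobiWaveFin a b N f t n

theorem jacobiWave_boundary (a b : ℕ → ℝ) (f : ℕ → ℂ) (t : ℕ) : jacobiWave a b f t 0 = f t := by
  match t with
  | 0 => simp [jacobiWave]
  | 1 => simp [jacobiWave]
  | t + 2 => simp [jacobiWave]

/-- Finite speed of propagation: at time `t` the sites `n > t` are at rest, so that the state at
time `T` is a vector in `ℂ^T`. -/
theorem jacobiWave_eq_zero (a b : ℕ → ℝ) (f : ℕ → ℂ) :
    ∀ t n : ℕ, t < n → jacobiWave a b f t n = 0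
  | 0, n, h => by simp [jacobiWave, Nat.pos_iff_ne_zero.mp h]
  | 1, n, h => by
      have h1 : n ≠ 0 := by omega
      have h2 : n - 1 ≠ 0 := by omega
      simp [jacobiWave, h1, h2]
  | t + 2, n, h => by
      have h1 : n ≠ 0 := by omega
      rw [jacobiWave, if_neg h1, jacobiWave_eq_zero a b f (t + 1) (n + 1) (by omega),
        jacobiWave_eq_zero a b f (t + 1) (n - 1) (by omega),
        jacobiWave_eq_zero a b f (t + 1) n (by omega),
        jacobiWave_eq_zero a b f t n (by omega)]
      simp

theorem jacobiWave_add (a b : ℕ → ℝ) (f g : ℕ → ℂ) :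
    ∀ t n : ℕ, jacobiWave a b (f + g) t n = jacobiWave a b f t n + jacobiWave a b g t n
  | 0, n => by simp only [jacobiWave]; split_ifs <;> simp
  | 1, n => by
      simp only [jacobiWave]
      split_ifs <;> simp <;> ring
  | t + 2, n => by
      simp only [jacobiWave, jacobiWave_add a b f g (t + 1), jacobiWave_add a b f g t]
      split_ifs
      · simp
      · ring

theorem jacobiWave_smul (a b : ℕ → ℝ) (c : ℂ) (f : ℕ → ℂ) :
    ∀ t n : ℕ, jacobiWave a b (c • f) t n = c * jacobiWave a b f t n
  | 0, n => by simp only [jacobiWave]; split_ifs <;> simp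
  | 1, n => by
      simp only [jacobiWave]
      split_ifs <;> simp <;> ring
  | t + 2, n => by
      simp only [jacobiWave, jacobiWave_smul a b c f (t + 1), jacobiWave_smul a b c f t]
      split_ifs
      · simp
      · ring

theorem jacobiWaveFin_add (a b : ℕ → ℝ) (N : ℕ) (f g : ℕ → ℂ) :
    ∀ t n : ℕ, jacobiWaveFin a b N (f + g) t n
      = jacobiWaveFin a b N f t n + jacobiWaveFin a b N g t n
  | 0, n => by simp only [jacobiWaveFin]; split_ifs <;> simp
  | 1, n => by
      simp only [jacobiWaveFin]
      split_ifs <;> simp <;> ring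
  | t + 2, n => by
      simp only [jacobiWaveFin, jacobiWaveFin_add a b N f g (t + 1),
        jacobiWaveFin_add a b N f g t]
      split_ifs
      · simp
      · simp
      · ring

theorem jacobiWaveFin_smul (a b : ℕ → ℝ) (N : ℕ) (c : ℂ) (f : ℕ → ℂ) :
    ∀ t n : ℕ, jacobiWaveFin a b N (c • f) t n = c * jacobiWaveFin a b N f t n
  | 0, n => by simp only [jacobiWaveFin]; split_ifs <;> simp
  | 1, n => by
      simp only [jacobiWaveFin]
      split_ifs <;> simp <;> ring
  | t + 2, n => by
      simp only [jacobiWaveFin, jacobiWaveFin_smul a b N c f (t + 1),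
        jacobiWaveFin_smul a b N c f t]
      split_ifs
      · simp
      · simp
      · ring

/-! ### Control and connecting operators -/

/-- A control `(f_0, …, f_{T-1})`, extended by zero to later times (the state at time `T` does not
depend on the extension). -/
def controlExtend (T : ℕ) (f : EuclideanSpace ℂ (Fin T)) : ℕ → ℂ :=
  fun t => if h : t < T then f ⟨t, h⟩ else 0

theorem controlExtend_add (T : ℕ) (f g : EuclideanSpace ℂ (Fin T)) :
    controlExtend T (f + g) = controlExtend T f + controlExtend T g := by
  funext t
  by_cases h : t < T <;> simp [controlExtend, h]

theorem controlExtend_smul (T : ℕ) (c : ℂ) (f : EuclideanSpace ℂ (Fin T)) :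
    controlExtend T (c • f) = c • controlExtend T f := by
  funext t
  by_cases h : t < T <;> simp [controlExtend, h]

/-- The control operator `W^T`: `(W^T f)_n = u^f_{n,T}`, `n = 1, …, T`. The entry `n` of a state
in `ℂ^T` has index `n - 1 : Fin T`. -/
def controlOp (a b : ℕ → ℝ) (T : ℕ) : EuclideanSpace ℂ (Fin T) →ₗ[ℂ] EuclideanSpace ℂ (Fin T) where
  toFun f := WithLp.toLp 2 fun i => jacobiWave a b (controlExtend T f) T (i + 1)
  map_add' f g := by
    ext i
    simp [controlExtend_add, jacobiWave_add]
  map_smul' c f := by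
    ext i
    simp [controlExtend_smul, jacobiWave_smul]

/-- The control operator `W^T_N` of the system on the sites `1, …, N`:
`(W^T_N f)_n = v^f_{n,T}`, `n = 1, …, N`. -/
def controlOpFin (a b : ℕ → ℝ) (N T : ℕ) :
    EuclideanSpace ℂ (Fin T) →ₗ[ℂ] EuclideanSpace ℂ (Fin N) where
  toFun f := WithLp.toLp 2 fun i => jacobiWaveFin a b N (controlExtend T f) T (i + 1)
  map_add' f g := by
    ext i
    simp [controlExtend_add, jacobiWaveFin_add]
  map_smul' c f := by
    ext i
    simp [controlExtend_smul, jacobiWaveFin_smul]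

/-- The reversal `J_T`: `(J_T f)_n = f_{T+1-n}`, `n = 1, …, T`. -/
def reversal (T : ℕ) : EuclideanSpace ℂ (Fin T) →ₗ[ℂ] EuclideanSpace ℂ (Fin T) where
  toFun f := WithLp.toLp 2 fun i => f (Fin.rev i)
  map_add' f g := by ext i; simp
  map_smul' c f := by ext i; simp

/-- The connecting operator `C^T = (W^T)^* W^T`. -/
def connectingOp (a b : ℕ → ℝ) (T : ℕ) :
    EuclideanSpace ℂ (Fin T) →ₗ[ℂ] EuclideanSpace ℂ (Fin T) :=
  LinearMap.adjoint (controlOp a b T) ∘ₗ controlOp a b T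

/-- The reversed connecting operator `C_T = J_T C^T J_T`. -/
def connectingOpRev (a b : ℕ → ℝ) (T : ℕ) :
    EuclideanSpace ℂ (Fin T) →ₗ[ℂ] EuclideanSpace ℂ (Fin T) :=
  reversal T ∘ₗ connectingOp a b T ∘ₗ reversal T

/-! ### The polynomials `𝒯_k` and `φ_n`, and the Fourier transform -/

/-- Chebyshev polynomials of the second kind, normalized by
`𝒯_{t+1} + 𝒯_{t-1} = x 𝒯_t`, `𝒯_0 = 0`, `𝒯_1 = 1`. -/
def chebyshevT : ℕ → ℂ → ℂ
  | 0, _ => 0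
  | 1, _ => 1
  | t + 2, x => x * chebyshevT (t + 1) x - chebyshevT t x

/-- The solution of `a_n φ_{n+1} + a_{n-1} φ_{n-1} + b_n φ_n = x φ_n` (`n ≥ 1`), `φ_0 = 0`,
`φ_1 = 1`. -/
def jacobiPhi (a b : ℕ → ℝ) : ℕ → ℂ → ℂ
  | 0, _ => 0
  | 1, _ => 1
  | n + 2, x => ((x - b (n + 1)) * jacobiPhi a b (n + 1) x - a n * jacobiPhi a b n x) / a (n + 1)

/-- The Fourier transform `h ↦ ∑_{n=1}^T h_n φ_n` of a state `h ∈ ℂ^T`. -/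
def fourierState (a b : ℕ → ℝ) (T : ℕ) : EuclideanSpace ℂ (Fin T) →ₗ[ℂ] (ℂ → ℂ) where
  toFun h := fun x => ∑ i : Fin T, h i * jacobiPhi a b (i + 1) x
  map_add' h k := by
    funext x
    simp [add_mul, Finset.sum_add_distrib]
  map_smul' c h := by
    funext x
    simp [Finset.mul_sum, mul_assoc]

/-- The map `(f_1, …, f_T) ↦ ∑_{k=1}^T f_k 𝒯_k`. -/
def chebyshevSum (T : ℕ) : EuclideanSpace ℂ (Fin T) →ₗ[ℂ] (ℂ → ℂ) where
  toFun f := fun x => ∑ i : Fin T, chebyshevT (i + 1) x * f i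
  map_add' h k := by
    funext x
    simp [mul_add, Finset.sum_add_distrib]
  map_smul' c h := by
    funext x
    simp [Finset.mul_sum, mul_left_comm]

/-- The space `B_A^T`: the Fourier images of the states `u^{J_T f}_{·,T}`, `f ∈ ℂ^T`, that is, of
the states reachable at time `T`. -/
def reachableFourier (a b : ℕ → ℝ) (T : ℕ) : Submodule ℂ (ℂ → ℂ) :=
  LinearMap.range (fourierState a b T ∘ₗ controlOp a b T ∘ₗ reversal T)

/-- The right-hand side `(𝒯_1(z), …, 𝒯_T(z))^*` of the Krein equation. -/
def kreinRHS (T : ℕ) (z : ℂ) : EuclideanSpace ℂ (Fin T) :=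
  WithLp.toLp 2 fun i => conj (chebyshevT (i + 1) z)

/-! ### De Branges spaces -/

/-- Hermite–Biehler functions. -/
def IsHermiteBiehler (E : ℂ → ℂ) : Prop :=
  Differentiable ℂ E ∧ ∀ z : ℂ, 0 < z.im → ‖E (conj z)‖ < ‖E z‖

/-- `f` (restricted to the open upper half-plane) belongs to the Hardy space `H_2`. -/
def MemHardyH2 (f : ℂ → ℂ) : Prop :=
  DifferentiableOn ℂ f {z : ℂ | 0 < z.im} ∧
    (⨆ y : {y : ℝ // 0 < y},
      (∫⁻ x : ℝ, ‖f ((x : ℂ) + ((y : ℝ) : ℂ) * Complex.I)‖ₑ ^ 2)) < ⊤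

/-- `F^#(z) = conj (F (conj z))`. -/
def sharp (F : ℂ → ℂ) : ℂ → ℂ := fun z => conj (F (conj z))

/-- The set of functions of the de Branges space `B(E)`. -/
def deBrangesSet (E : ℂ → ℂ) : Set (ℂ → ℂ) :=
  {F | Differentiable ℂ F ∧ MemHardyH2 (fun z => F z / E z) ∧
    MemHardyH2 (fun z => sharp F z / E z)}

/-- The integrand `conj (F) G / |E|²` of the scalar product of `B(E)`. -/
def deBrangesIntegrand (E F G : ℂ → ℂ) : ℝ → ℂ :=
  fun x => conj (F x) * G x / ((‖E x‖ ^ 2 : ℝ) : ℂ)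

/-- The scalar product of `B(E)`, conjugate linear in the first argument. -/
def deBrangesInner (E F G : ℂ → ℂ) : ℂ :=
  1 / (Real.pi : ℂ) * ∫ x : ℝ, deBrangesIntegrand E F G x

/-- The linear space `B` of functions, with the scalar product `ip`, is the de Branges space
`B(E)`. -/
def IsDeBrangesSpaceOf (B : Submodule ℂ (ℂ → ℂ)) (ip : InnerProductSpace.Core ℂ B)
    (E : ℂ → ℂ) : Prop :=
  IsHermiteBiehler E ∧ (B : Set (ℂ → ℂ)) = deBrangesSet E ∧
    ∀ F G : B, MeasureTheory.Integrable (deBrangesIntegrand E F G) ∧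
      ip.inner F G = deBrangesInner E F G

/-- The reproducing kernel of `B(E)` at `z`, as a function of `x ≠ conj z`. -/
def deBrangesKernel (E : ℂ → ℂ) (z x : ℂ) : ℂ :=
  (conj (E z) * E x - E (conj z) * conj (E (conj x))) / (2 * Complex.I * (conj z - x))

end

/-! Put û_t = ∑ u_{n,t} φ_n. Summation by parts moves the Jacobi operator onto φ, where it is
multiplication by λ. The wave vanishes ahead of its front and the end n = 0 contributes a_0 f_t =
f_t, so û_{t+1} + û_{t-1} = λ û_t + f_t: the Chebyshev recurrence with a source. Hence û_T = ∑
𝒯_{T-s} f_s (`fourierState_controlOp_reversal`). As φ_k and 𝒯_k both have degree k - 1, both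
families are bases of the polynomials of degree < T. So W^T J_T is invertible, C_T is positive
definite, and [F, G] is the standard inner product of the states, the one making φ_1, …, φ_T
orthonormal.

The Hermite–Biehler function is E = φ_T - i a_T φ_{T+1}. Christoffel–Darboux becomes the formula for
the de Branges kernel (`sum_conj_jacobiPhi_mul`). On the diagonal it gives |E(z)| > |E(conj z)|, and
since consecutive φ have no common zero, E has no zeros in the closed upper half-plane.

For such E of degree T, B(E) consists of the polynomials of degree < T (`deBrangesSet_polynomial`).
Rational functions that decay are in H_2; conversely, averaging over discs bounds H_2 functions by a
multiple of (Im z)^{-1/2}, and a Liouville argument leaves only polynomials.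

The scalar products agree because the kernel also reproduces values with respect to dx / (π|E|²), by
Cauchy's formula (`integral_sum_jacobiPhi_mul`); comparing coefficients makes the φ_n orthonormal
there (`deBrangesInner_fourierState`). Finally, pairing with the right-hand side of the Krein
equation is evaluation at z, so its solution steers to the state (conj φ_n(z))_n, whose Fourier
image is the kernel. -/

open Polynomial

/-! ### The orthogonal polynomials as polynomials -/

/-- The real polynomial whose values are `jacobiPhi a b n`. -/
noncomputable def jacobiPoly (a b : ℕ → ℝ) : ℕ → ℝ[X]
  | 0 => 0
  | 1 => 1
  | n + 2 => C (a (n + 1))⁻¹ *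
      ((X - C (b (n + 1))) * jacobiPoly a b (n + 1) - C (a n) * jacobiPoly a b n)

theorem aeval_jacobiPoly (a b : ℕ → ℝ) (x : ℂ) :
    ∀ n, aeval x (jacobiPoly a b n) = jacobiPhi a b n x
  | 0 => by simp [jacobiPoly, jacobiPhi]
  | 1 => by simp [jacobiPoly, jacobiPhi]
  | n + 2 => by
      simp [jacobiPoly, jacobiPhi, aeval_jacobiPoly a b x (n + 1), aeval_jacobiPoly a b x n]
      ring

theorem degree_jacobiPoly {a : ℕ → ℝ} (b : ℕ → ℝ) (ha : ∀ n, 0 < a n) (n : ℕ) :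
    (jacobiPoly a b (n + 1)).degree = n := by
  induction n using Nat.strong_induction_on with
  | _ n ih =>
    rcases n with _ | n
    · simp [jacobiPoly]
    have h1 := ih n (by omega)
    have h2 : (C (a n) * jacobiPoly a b n).degree < ((n + 1 : ℕ) : WithBot ℕ) := by
      rcases n with _ | n
      · simp [jacobiPoly]
      · rw [degree_C_mul (ha _).ne', ih n (by omega)]
        exact_mod_cast (by omega : n < n + 1 + 1)
    have h3 : ((X - C (b (n + 1))) * jacobiPoly a b (n + 1)).degree
        = ((n + 1 : ℕ) : WithBot ℕ) := by
      rw [degree_mul, degree_X_sub_C, h1]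
      push_cast
      rw [add_comm]
    rw [jacobiPoly, degree_C_mul (inv_ne_zero (ha _).ne'),
      degree_sub_eq_left_of_degree_lt (by rwa [h3]), h3]

/-- The polynomials `φ_1, φ_2, …` with complex coefficients, `φ_{i+1}` having degree `i`. -/
noncomputable def jacobiSequence (a b : ℕ → ℝ) (ha : ∀ n, 0 < a n) : Polynomial.Sequence ℂ where
  elems' i := (jacobiPoly a b (i + 1)).map (algebraMap ℝ ℂ)
  degree_eq' i := by rw [degree_map, degree_jacobiPoly b ha]

theorem jacobiSequence_apply (a b : ℕ → ℝ) (ha : ∀ n, 0 < a n) (i : ℕ) :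
    jacobiSequence a b ha i = (jacobiPoly a b (i + 1)).map (algebraMap ℝ ℂ) := rfl

theorem eval_jacobiSequence (a b : ℕ → ℝ) (ha : ∀ n, 0 < a n) (i : ℕ) (x : ℂ) :
    (jacobiSequence a b ha i).eval x = jacobiPhi a b (i + 1) x := by
  rw [jacobiSequence_apply, eval_map_algebraMap, aeval_jacobiPoly]

/-- The free case a = 1, b = 0: every fact about expansions in φ_n transfers to the 𝒯_k. -/
theorem chebyshevT_eq_jacobiPhi (x : ℂ) : ∀ n, chebyshevT n x = jacobiPhi 1 0 n x
  | 0 => by simp [chebyshevT, jacobiPhi]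
  | 1 => by simp [chebyshevT, jacobiPhi]
  | n + 2 => by
      simp [chebyshevT, jacobiPhi, chebyshevT_eq_jacobiPhi x (n + 1), chebyshevT_eq_jacobiPhi x n]

theorem chebyshevSum_eq_fourierState (T : ℕ) (f : EuclideanSpace ℂ (Fin T)) :
    chebyshevSum T f = fourierState 1 0 T f := by
  funext x
  simp [chebyshevSum, fourierState, chebyshevT_eq_jacobiPhi, mul_comm]

theorem conj_jacobiPhi (a b : ℕ → ℝ) (n : ℕ) (x : ℂ) :
    conj (jacobiPhi a b n x) = jacobiPhi a b n (conj x) := by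
  rw [← aeval_jacobiPoly, ← aeval_jacobiPoly]
  exact (aeval_algHom_apply Complex.conjAe.toAlgHom x (jacobiPoly a b n)).symm

theorem jacobiPhi_recurrence {a : ℕ → ℝ} (b : ℕ → ℝ) (ha : ∀ n, 0 < a n) (n : ℕ) (x : ℂ) :
    a (n + 1) * jacobiPhi a b (n + 2) x + a n * jacobiPhi a b n x
      + b (n + 1) * jacobiPhi a b (n + 1) x = x * jacobiPhi a b (n + 1) x := by
  have h : (a (n + 1) : ℂ) ≠ 0 := by exact_mod_cast (ha _).ne'
  rw [jacobiPhi]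
  field_simp
  ring

/-- Two consecutive values of `φ` do not vanish simultaneously. -/
theorem jacobiPhi_ne_zero_or {a : ℕ → ℝ} (b : ℕ → ℝ) (ha : ∀ n, 0 < a n) (x : ℂ) :
    ∀ n, jacobiPhi a b n x ≠ 0 ∨ jacobiPhi a b (n + 1) x ≠ 0
  | 0 => by simp [jacobiPhi]
  | n + 1 => by
      by_contra! h
      have h1 := jacobiPhi_recurrence b ha n x
      have h2 : (a n : ℂ) ≠ 0 := by exact_mod_cast (ha _).ne'
      rw [h.1, h.2] at h1
      have h3 : jacobiPhi a b n x = 0 := by simpa [h2] using h1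
      rcases jacobiPhi_ne_zero_or b ha x n with h4 | h4
      · exact h4 h3
      · exact h4 h.1

/-- The Christoffel–Darboux formula. -/
theorem christoffel_darboux {a : ℕ → ℝ} (b : ℕ → ℝ) (ha : ∀ n, 0 < a n) (x y : ℂ) (n : ℕ) :
    (x - y) * ∑ k ∈ Finset.Icc 1 n, jacobiPhi a b k y * jacobiPhi a b k x
      = a n * (jacobiPhi a b (n + 1) x * jacobiPhi a b n y
          - jacobiPhi a b n x * jacobiPhi a b (n + 1) y) := by
  induction n with
  | zero => simp [jacobiPhi]
  | succ n ih =>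
      rw [Finset.sum_Icc_succ_top (by omega), mul_add, ih]
      linear_combination (-jacobiPhi a b (n + 1) y) * jacobiPhi_recurrence b ha n x
        + jacobiPhi a b (n + 1) x * jacobiPhi_recurrence b ha n y

/-! ### Fourier images of vectors -/

theorem fourierState_eq_eval {a : ℕ → ℝ} (b : ℕ → ℝ) (ha : ∀ n, 0 < a n) (T : ℕ)
    (h : EuclideanSpace ℂ (Fin T)) :
    fourierState a b T h = fun x => (∑ i : Fin T, h i • jacobiSequence a b ha i).eval x := by
  funext x
  simp [fourierState, eval_finsetSum, eval_jacobiSequence]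

theorem degree_sum_jacobiSequence_lt {a : ℕ → ℝ} (b : ℕ → ℝ) (ha : ∀ n, 0 < a n) (T : ℕ)
    (h : Fin T → ℂ) : (∑ i : Fin T, h i • jacobiSequence a b ha i).degree < T := by
  rw [← mem_degreeLT]
  refine Submodule.sum_mem _ fun i _ => Submodule.smul_mem _ _ ?_
  rw [mem_degreeLT, Polynomial.Sequence.degree_eq]
  exact_mod_cast i.2

theorem fourierState_injective {a : ℕ → ℝ} (b : ℕ → ℝ) (ha : ∀ n, 0 < a n) (T : ℕ) :
    Function.Injective (fourierState a b T) := by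
  rw [injective_iff_map_eq_zero]
  intro h hh
  rw [fourierState_eq_eval b ha] at hh
  have h0 : ∑ i : Fin T, h i • jacobiSequence a b ha i = 0 :=
    Polynomial.funext fun x => by simpa using congrFun hh x
  have hli := (jacobiSequence a b ha).linearIndependent.comp _ (Fin.val_injective (n := T))
  ext i
  exact Fintype.linearIndependent_iff.1 hli (fun i => h i) h0 i

theorem range_fourierState {a : ℕ → ℝ} (b : ℕ → ℝ) (ha : ∀ n, 0 < a n) (T : ℕ) :
    Set.range (fourierState a b T) = {F | ∃ p : ℂ[X], p.degree < T ∧ F = fun x => p.eval x} := by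
  ext F
  constructor
  · rintro ⟨h, rfl⟩
    exact ⟨_, degree_sum_jacobiSequence_lt b ha T _, fourierState_eq_eval b ha T h⟩
  · rintro ⟨p, hp, rfl⟩
    -- Leading coefficients are units of ℂ, so the first T members span all polynomials of degree <
    -- T.
    rw [← mem_degreeLT, ← (jacobiSequence a b ha).span_degreeLT
      (fun i _ => ((jacobiSequence a b ha).ne_zero i |> leadingCoeff_ne_zero.2).isUnit)] at hp
    have himg : (jacobiSequence a b ha) '' Set.Iio T
        = Set.range (fun i : Fin T => jacobiSequence a b ha i) := by
      ext q
      simp only [Set.mem_image, Set.mem_Iio, Set.mem_range]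
      exact ⟨fun ⟨i, hi, h⟩ => ⟨⟨i, hi⟩, h⟩, fun ⟨i, h⟩ => ⟨i, i.2, h⟩⟩
    rw [himg, Submodule.mem_span_range_iff_exists_fun] at hp
    obtain ⟨c, hc⟩ := hp
    exact ⟨WithLp.toLp 2 c, by rw [fourierState_eq_eval b ha, ← hc]⟩

theorem chebyshevSum_injective (T : ℕ) : Function.Injective (chebyshevSum T) := by
  have h := fourierState_injective (a := 1) 0 (fun _ => one_pos) T
  intro f g hfg
  exact h (by rwa [← chebyshevSum_eq_fourierState, ← chebyshevSum_eq_fourierState])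

theorem range_chebyshevSum (T : ℕ) :
    Set.range (chebyshevSum T) = {F | ∃ p : ℂ[X], p.degree < T ∧ F = fun x => p.eval x} := by
  rw [← range_fourierState (a := 1) 0 (fun _ => one_pos) T]
  congr 1
  funext f
  exact chebyshevSum_eq_fourierState T f

/-- The 𝒯_k are real, so F ↦ F^# conjugates the coefficients; a real F is fixed, and injectivity
forces f = conj f. -/
theorem chebyshevSum_real_iff (T : ℕ) (f : EuclideanSpace ℂ (Fin T)) :
    (∃ p : ℝ[X], p.degree < T ∧ ∀ x : ℂ, chebyshevSum T f x = aeval x p) ↔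
      ∀ i, (f i).im = 0 := by
  constructor
  · rintro ⟨p, -, hp⟩ i
    have h : (WithLp.toLp 2 fun i => conj (f i) : EuclideanSpace ℂ (Fin T)) = f := by
      apply chebyshevSum_injective T
      funext x
      have h1 := congrArg conj (hp (conj x))
      have h2 : conj (aeval (conj x) p) = aeval x p := by
        have := aeval_algHom_apply Complex.conjAe.toAlgHom x p
        simpa using congrArg conj this
      rw [h2, ← hp x] at h1
      rw [← h1]
      simp [chebyshevSum, chebyshevT_eq_jacobiPhi, conj_jacobiPhi]
    have h3 := congrArg (fun g : EuclideanSpace ℂ (Fin T) => g i) h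
    exact Complex.conj_eq_iff_im.1 h3
  · intro hf
    refine ⟨∑ i : Fin T, C (f i).re * jacobiPoly 1 0 (i + 1), ?_, fun x => ?_⟩
    · rw [← mem_degreeLT]
      refine Submodule.sum_mem _ fun i _ => ?_
      rw [← smul_eq_C_mul]
      refine Submodule.smul_mem _ _ ?_
      rw [mem_degreeLT, degree_jacobiPoly (a := 1) 0 (fun _ => one_pos)]
      exact_mod_cast i.2
    · simp only [chebyshevSum, LinearMap.coe_mk, AddHom.coe_mk, map_sum, map_mul,
        aeval_jacobiPoly, aeval_C, chebyshevT_eq_jacobiPhi]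
      refine Finset.sum_congr rfl fun i _ => ?_
      have : (f i) = ((f i).re : ℂ) := by
        apply Complex.ext <;> simp [hf i]
      conv_lhs => rw [this]
      exact mul_comm _ _

/-! ### States of the dynamical system -/

theorem jacobiWave_succ_succ (a b : ℕ → ℝ) (f : ℕ → ℂ) (t n : ℕ) :
    jacobiWave a b f (t + 2) (n + 1) = a (n + 1) * jacobiWave a b f (t + 1) (n + 2)
      + a n * jacobiWave a b f (t + 1) n + b (n + 1) * jacobiWave a b f (t + 1) (n + 1)
      - jacobiWave a b f t (n + 1) := by
  simp [jacobiWave]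

/-- Summation by parts for the operator `u ↦ a_n u_{n+1} + a_{n-1} u_{n-1} + b_n u_n`. -/
theorem sum_jacobi_mul_jacobiPhi {a : ℕ → ℝ} (b : ℕ → ℝ) (ha : ∀ n, 0 < a n) (u : ℕ → ℂ) (x : ℂ)
    (N : ℕ) :
    ∑ n ∈ Finset.range N, (a (n + 1) * u (n + 2) + a n * u n + b (n + 1) * u (n + 1))
        * jacobiPhi a b (n + 1) x
      = x * ∑ n ∈ Finset.range N, u (n + 1) * jacobiPhi a b (n + 1) x + a 0 * u 0
        + a N * (u (N + 1) * jacobiPhi a b N x - u N * jacobiPhi a b (N + 1) x) := by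
  induction N with
  | zero => simp [jacobiPhi]
  | succ N ih =>
      rw [Finset.sum_range_succ, ih, Finset.sum_range_succ]
      linear_combination u (N + 1) * jacobiPhi_recurrence b ha N x

/-- At time t + 1 < N the sites N and N + 1 are still at rest, so of the boundary terms only a_0 u_0
survives: the source. -/
theorem sum_jacobiWave_succ_succ {a : ℕ → ℝ} (b : ℕ → ℝ) (ha : ∀ n, 0 < a n) (ha0 : a 0 = 1)
    (f : ℕ → ℂ) (x : ℂ) {N t : ℕ} (ht : t + 1 < N) :
    ∑ n ∈ Finset.range N, jacobiWave a b f (t + 2) (n + 1) * jacobiPhi a b (n + 1) x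
      = x * ∑ n ∈ Finset.range N, jacobiWave a b f (t + 1) (n + 1) * jacobiPhi a b (n + 1) x
        + f (t + 1)
        - ∑ n ∈ Finset.range N, jacobiWave a b f t (n + 1) * jacobiPhi a b (n + 1) x := by
  have h := sum_jacobi_mul_jacobiPhi b ha (jacobiWave a b f (t + 1)) x N
  rw [jacobiWave_eq_zero a b f (t + 1) (N + 1) (by omega),
    jacobiWave_eq_zero a b f (t + 1) N (by omega), jacobiWave_boundary, ha0] at h
  simp only [jacobiWave_succ_succ, sub_mul, Finset.sum_sub_distrib, h]
  simp

/-- The Fourier image of the state at time `t`. -/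
theorem sum_jacobiWave_mul_jacobiPhi {a : ℕ → ℝ} (b : ℕ → ℝ) (ha : ∀ n, 0 < a n) (ha0 : a 0 = 1)
    (f : ℕ → ℂ) (x : ℂ) {N : ℕ} : ∀ t, t ≤ N →
    ∑ n ∈ Finset.range N, jacobiWave a b f t (n + 1) * jacobiPhi a b (n + 1) x
      = ∑ s ∈ Finset.range t, chebyshevT (t - s) x * f s
  | 0, _ => by simp [jacobiWave]
  | 1, h => by
      obtain ⟨M, rfl⟩ : ∃ M, N = M + 1 := ⟨N - 1, by omega⟩
      rw [Finset.sum_range_succ', Finset.sum_eq_zero]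
      · simp [jacobiWave, jacobiPhi, chebyshevT, ha0]
      · intro n _
        rw [jacobiWave_eq_zero _ _ _ _ _ (by omega), zero_mul]
  | t + 2, h => by
      rw [sum_jacobiWave_succ_succ b ha ha0 f x (by omega),
        sum_jacobiWave_mul_jacobiPhi b ha ha0 f x (t + 1) (by omega),
        sum_jacobiWave_mul_jacobiPhi b ha ha0 f x t (by omega)]
      -- The extra term s = t carries 𝒯_0 = 0; with it both sums run over s ≤ t and the Chebyshev
      -- recurrence applies termwise. The remaining term s = t + 1 carries 𝒯_1 = 1.
      have h1 : ∑ s ∈ Finset.range t, chebyshevT (t - s) x * f s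
          = ∑ s ∈ Finset.range (t + 1), chebyshevT (t - s) x * f s := by
        rw [Finset.sum_range_succ]
        simp [chebyshevT]
      rw [h1, Finset.sum_range_succ _ (t + 1), Finset.mul_sum, add_sub_right_comm,
        ← Finset.sum_sub_distrib]
      congr 1
      · refine Finset.sum_congr rfl fun s hs => ?_
        have hs' := Finset.mem_range.1 hs
        rw [show t + 2 - s = (t - s) + 2 by omega, show t + 1 - s = (t - s) + 1 by omega, chebyshevT]
        ring
      · rw [show t + 2 - (t + 1) = 1 by omega]
        simp [chebyshevT]

theorem fourierState_controlOp_reversal {a : ℕ → ℝ} (b : ℕ → ℝ) (ha : ∀ n, 0 < a n)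
    (ha0 : a 0 = 1) (T : ℕ) (f : EuclideanSpace ℂ (Fin T)) :
    fourierState a b T (controlOp a b T (reversal T f)) = chebyshevSum T f := by
  funext x
  have h := sum_jacobiWave_mul_jacobiPhi b ha ha0 (controlExtend T (reversal T f)) x T le_rfl
  rw [← Fin.sum_univ_eq_sum_range
    (fun n => jacobiWave a b (controlExtend T (reversal T f)) T (n + 1) * jacobiPhi a b (n + 1) x),
    ← Fin.sum_univ_eq_sum_range
    (fun s => chebyshevT (T - s) x * controlExtend T (reversal T f) s)] at h
  refine h.trans ?_
  rw [← Equiv.sum_comp Fin.revPerm]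
  refine Finset.sum_congr rfl fun i _ => ?_
  have hi := i.2
  -- The control entry at time s has coefficient 𝒯_{T-s}, and reversal puts f_{i+1} at time s = T -
  -- 1 - i.
  have e1 : T - ((Fin.rev i : Fin T) : ℕ) = i + 1 := by rw [Fin.val_rev]; omega
  simp [controlExtend, reversal, e1, -Fin.val_rev]

/-- Up to time N the wave has not gone beyond site N, so the condition at N + 1 is not felt. -/
theorem jacobiWaveFin_eq_jacobiWave (a b : ℕ → ℝ) (N : ℕ) (f : ℕ → ℂ) :
    ∀ t n : ℕ, t ≤ N → jacobiWaveFin a b N f t n = jacobiWave a b f t n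
  | 0, n, _ => by simp [jacobiWaveFin, jacobiWave]
  | 1, n, h => by
      by_cases hn : N < n
      · rw [jacobiWave_eq_zero _ _ _ _ _ (by omega)]
        simp [jacobiWaveFin, hn, show n ≠ 0 by omega]
      · simp [jacobiWaveFin, jacobiWave, hn]
  | t + 2, n, h => by
      by_cases hn : N < n
      · rw [jacobiWave_eq_zero _ _ _ _ _ (by omega)]
        simp [jacobiWaveFin, hn, show n ≠ 0 by omega]
      · simp only [jacobiWaveFin, jacobiWave, hn, if_false,
          jacobiWaveFin_eq_jacobiWave a b N f (t + 1) _ (by omega : t + 1 ≤ N),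
          jacobiWaveFin_eq_jacobiWave a b N f t _ (by omega : t ≤ N)]

theorem controlOpFin_eq_controlOp (a b : ℕ → ℝ) (T : ℕ) (f : EuclideanSpace ℂ (Fin T)) :
    controlOpFin a b T T f = controlOp a b T f := by
  ext i
  exact jacobiWaveFin_eq_jacobiWave a b T _ T _ le_rfl

theorem inner_reversal_left (T : ℕ) (f g : EuclideanSpace ℂ (Fin T)) :
    inner ℂ (reversal T f) g = inner ℂ f (reversal T g) := by
  simp only [PiLp.inner_apply]
  rw [← Equiv.sum_comp Fin.revPerm]
  simp [reversal]

theorem reversal_reversal (T : ℕ) (f : EuclideanSpace ℂ (Fin T)) :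
    reversal T (reversal T f) = f := by
  ext i
  simp [reversal]

/-- `(C_T f, g)` is the inner product of the states reached by the reversed controls. -/
theorem inner_connectingOpRev (a b : ℕ → ℝ) (T : ℕ) (f g : EuclideanSpace ℂ (Fin T)) :
    inner ℂ (connectingOpRev a b T f) g
      = inner ℂ (controlOp a b T (reversal T f)) (controlOp a b T (reversal T g)) := by
  simp only [connectingOpRev, connectingOp, LinearMap.comp_apply]
  rw [inner_reversal_left, LinearMap.adjoint_inner_left]

/-- The state determines its Fourier image, whose coefficients in the basis 𝒯_k are the control. -/
theorem controlOp_reversal_injective {a : ℕ → ℝ} (b : ℕ → ℝ) (ha : ∀ n, 0 < a n)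
    (ha0 : a 0 = 1) (T : ℕ) :
    Function.Injective (controlOp a b T ∘ₗ reversal T) := by
  intro f g hfg
  apply chebyshevSum_injective T
  rw [← fourierState_controlOp_reversal b ha ha0, ← fourierState_controlOp_reversal b ha ha0]
  exact congrArg _ hfg

theorem controlOp_reversal_surjective {a : ℕ → ℝ} (b : ℕ → ℝ) (ha : ∀ n, 0 < a n)
    (ha0 : a 0 = 1) (T : ℕ) :
    Function.Surjective (controlOp a b T ∘ₗ reversal T) :=
  LinearMap.surjective_of_injective (controlOp_reversal_injective b ha ha0 T)

theorem connectingOpRev_bijective {a : ℕ → ℝ} (b : ℕ → ℝ) (ha : ∀ n, 0 < a n)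
    (ha0 : a 0 = 1) (T : ℕ) : Function.Bijective (connectingOpRev a b T) := by
  have h : Function.Injective (connectingOpRev a b T) := by
    rw [injective_iff_map_eq_zero]
    intro f hf
    have h1 := inner_connectingOpRev a b T f f
    rw [hf, inner_zero_left, eq_comm, inner_self_eq_zero] at h1
    exact (injective_iff_map_eq_zero _).1 (controlOp_reversal_injective b ha ha0 T) f h1
  exact ⟨h, LinearMap.surjective_of_injective h⟩

theorem reachableFourier_eq_range {a : ℕ → ℝ} (b : ℕ → ℝ) (ha : ∀ n, 0 < a n)
    (ha0 : a 0 = 1) (T : ℕ) :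
    reachableFourier a b T = LinearMap.range (fourierState a b T) := by
  rw [reachableFourier, LinearMap.range_comp_of_range_eq_top]
  exact LinearMap.range_eq_top.2 (controlOp_reversal_surjective b ha ha0 T)

/-! ### Rational functions on the closed upper half-plane -/

theorem withBot_add_one_le_of_lt {m n : WithBot ℕ} (h : m < n) : m + 1 ≤ n := by
  induction m with
  | bot => simp
  | coe m =>
    induction n with
    | bot => simp at h
    | coe n =>
      exact WithBot.coe_le_coe.2 (Nat.succ_le_of_lt (WithBot.coe_lt_coe.1 h))

/-- The degrees decide near infinity; on the remaining compact half-disc the quotient is continuous.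
-/
theorem exists_norm_eval_le_mul_norm_eval {P D : ℂ[X]} (hdeg : P.degree ≤ D.degree)
    (hD : ∀ z : ℂ, 0 ≤ z.im → D.eval z ≠ 0) :
    ∃ C : ℝ, 0 ≤ C ∧ ∀ z : ℂ, 0 ≤ z.im → ‖P.eval z‖ ≤ C * ‖D.eval z‖ := by
  obtain ⟨c, hc⟩ := (isBigO_cobounded_of_degree_le hdeg).bound
  rw [← comap_norm_atTop, Filter.eventually_comap, Filter.eventually_atTop] at hc
  obtain ⟨R, hR⟩ := hc
  have hK : IsCompact (Metric.closedBall (0 : ℂ) R ∩ {z | 0 ≤ z.im}) :=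
    (isCompact_closedBall _ _).inter_right (isClosed_le continuous_const Complex.continuous_im)
  have hcont : ContinuousOn (fun z => P.eval z / D.eval z)
      (Metric.closedBall (0 : ℂ) R ∩ {z | 0 ≤ z.im}) :=
    P.continuousOn.div D.continuousOn fun z hz => hD z hz.2
  obtain ⟨c', hc'⟩ := hK.exists_bound_of_continuousOn hcont
  refine ⟨max 0 (max c c'), le_max_left _ _, fun z hz => ?_⟩
  rcases le_total R ‖z‖ with h | h
  · refine (hR _ h z rfl).trans ?_
    gcongr
    exact (le_max_left _ _).trans (le_max_right _ _)
  · have h1 := hc' z ⟨by simpa using h, hz⟩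
    rw [norm_div, div_le_iff₀ (norm_pos_iff.2 (hD z hz))] at h1
    refine h1.trans ?_
    gcongr
    exact (le_max_right _ _).trans (le_max_right _ _)

theorem exists_norm_sq_eval_mul_le {P D : ℂ[X]} (hdeg : P.degree < D.degree)
    (hD : ∀ z : ℂ, 0 ≤ z.im → D.eval z ≠ 0) :
    ∃ C : ℝ, 0 ≤ C ∧ ∀ z : ℂ, 0 ≤ z.im →
      ‖P.eval z‖ ^ 2 * (1 + ‖z‖ ^ 2) ≤ C * ‖D.eval z‖ ^ 2 := by
  obtain ⟨c, hc0, hc⟩ := exists_norm_eval_le_mul_norm_eval hdeg.le hD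
  have h2 : (X * P).degree ≤ D.degree := by
    rw [degree_mul, degree_X, add_comm]
    exact withBot_add_one_le_of_lt hdeg
  obtain ⟨c', hc0', hc'⟩ := exists_norm_eval_le_mul_norm_eval h2 hD
  refine ⟨c ^ 2 + c' ^ 2, by positivity, fun z hz => ?_⟩
  have h3 := pow_le_pow_left₀ (norm_nonneg _) (hc z hz) 2
  have h4 := pow_le_pow_left₀ (norm_nonneg _) (hc' z hz) 2
  rw [eval_mul, eval_X, norm_mul] at h4
  nlinarith

theorem exists_norm_eval_mul_le {P D : ℂ[X]} (hdeg : P.degree + 2 ≤ D.degree)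
    (hD : ∀ z : ℂ, 0 ≤ z.im → D.eval z ≠ 0) :
    ∃ C : ℝ, 0 ≤ C ∧ ∀ z : ℂ, 0 ≤ z.im →
      ‖P.eval z / D.eval z‖ ≤ C * (1 + ‖z‖ ^ 2)⁻¹ := by
  have h1 : P.degree ≤ D.degree := le_trans (le_add_of_nonneg_right (by norm_num)) hdeg
  obtain ⟨c, hc0, hc⟩ := exists_norm_eval_le_mul_norm_eval h1 hD
  have h2 : (X ^ 2 * P).degree ≤ D.degree := by
    rw [degree_mul, degree_X_pow, add_comm]
    exact_mod_cast hdeg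
  obtain ⟨c', hc0', hc'⟩ := exists_norm_eval_le_mul_norm_eval h2 hD
  refine ⟨c + c', by positivity, fun z hz => ?_⟩
  have h3 := hc z hz
  have h4 := hc' z hz
  rw [eval_mul, eval_pow, eval_X, norm_mul, norm_pow] at h4
  rw [norm_div, div_le_iff₀ (norm_pos_iff.2 (hD z hz)), mul_right_comm, ← div_eq_mul_inv,
    le_div_iff₀ (by positivity)]
  linarith

theorem integrable_rational {P D : ℂ[X]} (hdeg : P.degree + 2 ≤ D.degree)
    (hD : ∀ z : ℂ, 0 ≤ z.im → D.eval z ≠ 0) :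
    MeasureTheory.Integrable fun x : ℝ => P.eval (x : ℂ) / D.eval (x : ℂ) := by
  obtain ⟨C, hC0, hC⟩ := exists_norm_eval_mul_le hdeg hD
  refine (integrable_inv_one_add_sq.const_mul C).mono' ?_ ?_
  · refine Continuous.aestronglyMeasurable ?_
    exact (P.continuous.comp Complex.continuous_ofReal).div
      (D.continuous.comp Complex.continuous_ofReal) fun x => hD x (by simp)
  · refine Filter.Eventually.of_forall fun x => ?_
    simpa using hC x (by simp)

open MeasureTheory Filter Topology in
/-- The integral over the real line of a rational function without poles in the closed upper
half-plane which is `O(|z|⁻²)` at infinity vanishes. -/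
theorem integral_rational_eq_zero {P D : ℂ[X]} (hdeg : P.degree + 2 ≤ D.degree)
    (hD : ∀ z : ℂ, 0 ≤ z.im → D.eval z ≠ 0) :
    ∫ x : ℝ, P.eval (x : ℂ) / D.eval (x : ℂ) = 0 := by
  obtain ⟨C, hC0, hC⟩ := exists_norm_eval_mul_le hdeg hD
  have hlim := intervalIntegral_tendsto_integral (integrable_rational hdeg hD)
    tendsto_neg_atTop_atBot tendsto_id
  refine tendsto_nhds_unique hlim ?_
  -- Cauchy's theorem on the rectangle [-R, R] × [0, R]: the other three sides have total length 4R,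
  -- and the integrand there is at most C / R².
  have hbound : ∀ R : ℝ, 0 < R →
      ‖∫ x in (-R)..R, P.eval (x : ℂ) / D.eval (x : ℂ)‖ ≤ 4 * C * R⁻¹ := by
    intro R hR
    have hC' : ∀ z : ℂ, 0 ≤ z.im → R ≤ ‖z‖ → ‖P.eval z / D.eval z‖ ≤ C * (R ^ 2)⁻¹ := by
      intro z hz hzR
      refine (hC z hz).trans ?_
      gcongr
      nlinarith
    have hdiff : DifferentiableOn ℂ (fun z : ℂ => P.eval z / D.eval z)
        (Set.uIcc (-R : ℂ).re (R + R * Complex.I : ℂ).re ×ℂ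
          Set.uIcc (-R : ℂ).im (R + R * Complex.I : ℂ).im) := by
      refine P.differentiable.differentiableOn.div D.differentiable.differentiableOn fun z hz => ?_
      have h1 := hz.2
      simp only [Complex.neg_im, Complex.ofReal_im, neg_zero, Complex.add_im, Complex.mul_im,
        Complex.ofReal_re, Complex.I_im, mul_one, Complex.I_re, mul_zero, add_zero, zero_add,
        Set.mem_preimage, Set.uIcc_of_le hR.le] at h1
      exact hD z h1.1
    have hrect := Complex.integral_boundary_rect_eq_zero_of_differentiableOn _ _ _ hdiff
    simp only [Complex.neg_im, Complex.ofReal_im, neg_zero, Complex.add_im, Complex.mul_im,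
        Complex.ofReal_re, Complex.I_im, mul_one, Complex.I_re, mul_zero, add_zero, zero_add,
        Complex.neg_re, Complex.add_re, Complex.mul_re, sub_zero, Complex.ofReal_zero, zero_mul]
        at hrect
    have htop : ‖∫ x : ℝ in (-R)..R, P.eval (x + R * Complex.I : ℂ) / D.eval (x + R * Complex.I : ℂ)‖
        ≤ C * (R ^ 2)⁻¹ * |R - (-R)| := by
      refine intervalIntegral.norm_integral_le_of_norm_le_const fun x _ => hC' _ ?_ ?_
      · simpa using hR.le
      · simpa [abs_of_pos hR] using Complex.abs_im_le_norm (x + R * Complex.I : ℂ)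
    have hright : ‖∫ y : ℝ in (0 : ℝ)..R,
        P.eval ((R : ℂ) + y * Complex.I) / D.eval ((R : ℂ) + y * Complex.I)‖
        ≤ C * (R ^ 2)⁻¹ * |R - 0| := by
      refine intervalIntegral.norm_integral_le_of_norm_le_const fun y hy => hC' _ ?_ ?_
      · rw [Set.uIoc_of_le hR.le] at hy
        simpa using hy.1.le
      · simpa [abs_of_pos hR] using Complex.abs_re_le_norm (R + y * Complex.I : ℂ)
    have hleft : ‖∫ y : ℝ in (0 : ℝ)..R,
        P.eval (((-R : ℝ) : ℂ) + y * Complex.I) / D.eval (((-R : ℝ) : ℂ) + y * Complex.I)‖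
        ≤ C * (R ^ 2)⁻¹ * |R - 0| := by
      refine intervalIntegral.norm_integral_le_of_norm_le_const fun y hy => hC' _ ?_ ?_
      · rw [Set.uIoc_of_le hR.le] at hy
        simpa using hy.1.le
      · simpa [abs_of_pos hR] using Complex.abs_re_le_norm (((-R : ℝ) : ℂ) + y * Complex.I : ℂ)
    set A := ∫ x : ℝ in (-R)..R, P.eval (x : ℂ) / D.eval (x : ℂ)
    set B := ∫ x : ℝ in (-R)..R, P.eval (x + R * Complex.I : ℂ) / D.eval (x + R * Complex.I : ℂ)
    set U := ∫ y : ℝ in (0 : ℝ)..R,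
        P.eval ((R : ℂ) + y * Complex.I) / D.eval ((R : ℂ) + y * Complex.I)
    set V := ∫ y : ℝ in (0 : ℝ)..R,
        P.eval (((-R : ℝ) : ℂ) + y * Complex.I) / D.eval (((-R : ℝ) : ℂ) + y * Complex.I)
    have hA : A = B - Complex.I • U + Complex.I • V := by linear_combination hrect
    rw [hA]
    refine (norm_add_le _ _).trans ((add_le_add_left (norm_sub_le _ _) _).trans ?_)
    rw [norm_smul, norm_smul, Complex.norm_I, one_mul, one_mul]
    rw [show R - -R = 2 * R by ring, abs_of_pos (by positivity)] at htop
    rw [sub_zero, abs_of_pos hR] at hright hleft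
    have h5 : 4 * C * R⁻¹ = C * (R ^ 2)⁻¹ * (2 * R) + C * (R ^ 2)⁻¹ * R + C * (R ^ 2)⁻¹ * R := by
      field_simp
      ring
    linarith
  refine squeeze_zero_norm' (eventually_atTop.2 ⟨1, fun R hR => hbound R (by linarith)⟩) ?_
  simpa using tendsto_inv_atTop_zero.const_mul (4 * C)

-- The half-plane Poisson kernel; it supplies the non-zero part of the Cauchy integral below.
open MeasureTheory in
theorem integral_poisson (u : ℝ) {v : ℝ} (hv : 0 < v) :
    Integrable (fun x : ℝ => v / ((x - u) ^ 2 + v ^ 2)) ∧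
      ∫ x : ℝ, v / ((x - u) ^ 2 + v ^ 2) = Real.pi := by
  have h : (fun x : ℝ => v / ((x - u) ^ 2 + v ^ 2))
      = fun x => v⁻¹ * (1 + ((x - u) / v) ^ 2)⁻¹ := by
    funext x
    have : (x - u) ^ 2 + v ^ 2 ≠ 0 := by positivity
    have : v ^ 2 + (x - u) ^ 2 ≠ 0 := by positivity
    field_simp
    ring
  rw [h]
  constructor
  · exact (((integrable_inv_one_add_sq.comp_div hv.ne').comp_sub_right u)).const_mul _
  · rw [integral_const_mul,
      integral_sub_right_eq_self (fun x : ℝ => (1 + (x / v) ^ 2)⁻¹) u,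
      Measure.integral_comp_div (fun x : ℝ => (1 + x ^ 2)⁻¹) v, integral_univ_inv_one_add_sq,
      abs_of_pos hv, smul_eq_mul, inv_mul_cancel_left₀ hv.ne']

open MeasureTheory in
/-- The Cauchy integral formula in the upper half-plane for the rational function `F / E`. -/
theorem integral_cauchy_rational {F E : ℂ[X]} (hdeg : F.degree < E.degree)
    (hE : ∀ z : ℂ, 0 ≤ z.im → E.eval z ≠ 0) {w : ℂ} (hw : 0 < w.im) :
    Integrable (fun x : ℝ => F.eval (x : ℂ) / (E.eval (x : ℂ) * (x - w))) ∧
      ∫ x : ℝ, F.eval (x : ℂ) / (E.eval (x : ℂ) * (x - w))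
        = 2 * Real.pi * Complex.I * (F.eval w / E.eval w) := by
  have hEw := hE w hw.le
  have hw2 : w - conj w = 2 * Complex.I * w.im := by
    rw [Complex.sub_conj]; push_cast; ring
  -- Subtracting F(w)/E(w) · 2i Im w / ((x - w)(x - conj w)) from F / (E (x - w)) removes the pole
  -- at w. What remains is Q / (E(w) (x - conj w) E), without poles in the closed upper half-plane,
  -- and the subtracted term is a multiple of the Poisson kernel.
  obtain ⟨Q, hQ⟩ : X - C w ∣ F * (X - C (conj w)) * C (E.eval w)
      - C (F.eval w * (2 * Complex.I * w.im)) * E := by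
    rw [dvd_iff_isRoot, IsRoot.def]
    simp only [eval_sub, eval_mul, eval_X, eval_C, hw2]
    ring
  have hE0 : E ≠ 0 := by rintro rfl; simp at hEw
  have hdegQ : Q.degree < E.degree := by
    have h1 : (F * (X - C (conj w)) * C (E.eval w)
        - C (F.eval w * (2 * Complex.I * w.im)) * E).degree ≤ E.degree := by
      refine (degree_sub_le _ _).trans (max_le ?_ ?_)
      · rw [degree_mul_C hEw, degree_mul, degree_X_sub_C]
        exact withBot_add_one_le_of_lt hdeg
      · rw [← smul_eq_C_mul]
        exact degree_smul_le _ _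
    by_cases hQ0 : Q = 0
    · rw [hQ0, degree_zero]; exact bot_lt_iff_ne_bot.2 (degree_ne_bot.2 hE0)
    rw [hQ, degree_mul, degree_X_sub_C, add_comm, degree_eq_natDegree hQ0,
      degree_eq_natDegree hE0] at h1
    rw [degree_eq_natDegree hQ0, degree_eq_natDegree hE0]
    have h2 : Q.natDegree + 1 ≤ E.natDegree := by exact_mod_cast h1
    exact_mod_cast h2
  have hD : ∀ z : ℂ, 0 ≤ z.im → (C (E.eval w) * ((X - C (conj w)) * E)).eval z ≠ 0 := by
    intro z hz
    simp only [eval_mul, eval_C, eval_sub, eval_X]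
    refine mul_ne_zero hEw (mul_ne_zero (sub_ne_zero.2 ?_) (hE z hz))
    rintro rfl
    rw [Complex.conj_im] at hz
    linarith
  have hdegD : Q.degree + 2 ≤ (C (E.eval w) * ((X - C (conj w)) * E)).degree := by
    rw [degree_C_mul hEw, degree_mul, degree_X_sub_C]
    have h1 := withBot_add_one_le_of_lt hdegQ
    calc Q.degree + 2 = 1 + (Q.degree + 1) := by rw [add_comm 1, add_assoc]; norm_num
      _ ≤ _ := by gcongr
  have key : ∀ x : ℝ, F.eval (x : ℂ) / (E.eval (x : ℂ) * (x - w))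
      = Q.eval (x : ℂ) / (C (E.eval w) * ((X - C (conj w)) * E)).eval (x : ℂ)
        + F.eval w / E.eval w * (2 * Complex.I) * ((w.im / ((x - w.re) ^ 2 + w.im ^ 2) : ℝ) : ℂ) := by
    intro x
    have h1 := congrArg (eval (x : ℂ)) hQ
    simp only [eval_sub, eval_mul, eval_X, eval_C] at h1
    have hx := hE x (by simp)
    have hxw : (x : ℂ) - w ≠ 0 := fun h => by
      have := congrArg Complex.im h; simp at this; linarith
    have hxw' : (x : ℂ) - conj w ≠ 0 := fun h => by
      have := congrArg Complex.im h; simp at this; linarith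
    have h3 : (((x - w.re) ^ 2 + w.im ^ 2 : ℝ) : ℂ) = (x - w) * (x - conj w) := by
      apply Complex.ext <;> simp [pow_two]
      ring
    rw [Complex.ofReal_div, h3]
    simp only [eval_sub, eval_mul, eval_X, eval_C]
    field_simp
    linear_combination h1
  obtain ⟨hp1, hp2⟩ := integral_poisson w.re hw
  have hi1 := integrable_rational hdegD hD
  have hi2 : Integrable fun x : ℝ => F.eval w / E.eval w * (2 * Complex.I) *
      ((w.im / ((x - w.re) ^ 2 + w.im ^ 2) : ℝ) : ℂ) := (hp1.ofReal (𝕜 := ℂ)).const_mul _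
  constructor
  · exact (hi1.add hi2).congr (Filter.Eventually.of_forall fun x => (key x).symm)
  · rw [integral_congr_ae (Filter.Eventually.of_forall key)]
    refine (integral_add hi1 hi2).trans ?_
    rw [integral_rational_eq_zero hdegD hD, integral_const_mul]
    have h4 := integral_ofReal (𝕜 := ℂ) (μ := volume)
      (f := fun x : ℝ => w.im / ((x - w.re) ^ 2 + w.im ^ 2))
    rw [hp2] at h4
    erw [h4]
    simp only [Complex.coe_algebraMap]
    ring

/-! ### Entire functions of polynomial growth off the real axis -/

theorem norm_sq_sub_norm_sq (z : ℂ) : ‖z ^ 2 - (‖z‖ : ℂ) ^ 2‖ = 2 * ‖z‖ * |z.im| := by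
  have h : z ^ 2 - (‖z‖ : ℂ) ^ 2 = z * (2 * Complex.I * z.im) := by
    rw [← Complex.mul_conj', pow_two, ← mul_sub, Complex.sub_conj]
    push_cast; ring
  rw [h]
  simp
  ring

-- The factor ζ² - ρ² has modulus 2ρ|Im ζ| on |ζ| = ρ, which absorbs the blow-up |Im ζ|^{-1/2} at
-- ±ρ. The maximum principle then bounds the product inside, and for |z| ≤ ρ/2 the factor is at
-- least ρ²/2.
open Metric in
theorem norm_le_of_norm_mul_sqrt_im_le {F : ℂ → ℂ} (hF : Differentiable ℂ F) {K : ℝ} (hK : 0 ≤ K)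
    {m : ℕ} (h : ∀ z : ℂ, z.im ≠ 0 → ‖F z‖ * √|z.im| ≤ K * (1 + ‖z‖) ^ m) {ρ : ℝ} (hρ : 0 < ρ)
    {z : ℂ} (hz : ‖z‖ ≤ ρ / 2) : ‖F z‖ * √ρ ≤ 4 * K * (1 + ρ) ^ m := by
  have hsphere : ∀ ζ ∈ frontier (ball (0 : ℂ) ρ),
      ‖(ζ ^ 2 - (ρ : ℂ) ^ 2) * F ζ‖ ≤ 2 * ρ * √ρ * (K * (1 + ρ) ^ m) := by
    intro ζ hζ
    rw [frontier_ball _ hρ.ne', mem_sphere_zero_iff_norm] at hζ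
    rw [norm_mul, ← hζ, norm_sq_sub_norm_sq]
    by_cases hi : ζ.im = 0
    · rw [hi]; simp; positivity
    · have h1 := h ζ hi
      have h2 : √|ζ.im| ≤ √‖ζ‖ := Real.sqrt_le_sqrt (Complex.abs_im_le_norm ζ)
      have h3 : |ζ.im| = √|ζ.im| * √|ζ.im| := (Real.mul_self_sqrt (abs_nonneg _)).symm
      calc 2 * ‖ζ‖ * |ζ.im| * ‖F ζ‖ = 2 * ‖ζ‖ * √|ζ.im| * (‖F ζ‖ * √|ζ.im|) := by
            conv_lhs => rw [h3]
            ring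
        _ ≤ _ := by gcongr
  have hd : Differentiable ℂ fun ζ : ℂ => (ζ ^ 2 - (ρ : ℂ) ^ 2) * F ζ := by fun_prop
  have hzc : z ∈ closure (ball (0 : ℂ) ρ) := by
    rw [closure_ball _ hρ.ne', mem_closedBall_zero_iff]; linarith
  have hmax := Complex.norm_le_of_forall_mem_frontier_norm_le isBounded_ball hd.diffContOnCl
    hsphere hzc
  have hlow : ρ ^ 2 / 2 ≤ ‖z ^ 2 - (ρ : ℂ) ^ 2‖ := by
    have h1 := norm_sub_norm_le ((ρ : ℂ) ^ 2) (z ^ 2)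
    rw [norm_sub_rev] at h1
    simp only [norm_pow, Complex.norm_real, Real.norm_eq_abs, sq_abs] at h1
    nlinarith [norm_nonneg z]
  rw [norm_mul] at hmax
  have h5 : ρ ^ 2 / 2 * ‖F z‖ ≤ 2 * ρ * √ρ * (K * (1 + ρ) ^ m) :=
    (mul_le_mul_of_nonneg_right hlow (norm_nonneg _)).trans hmax
  have h6 : √ρ * √ρ = ρ := Real.mul_self_sqrt hρ.le
  have h7 : ρ ^ 2 / 2 * (‖F z‖ * √ρ) ≤ ρ ^ 2 / 2 * (4 * K * (1 + ρ) ^ m) := by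
    calc ρ ^ 2 / 2 * (‖F z‖ * √ρ) = (ρ ^ 2 / 2 * ‖F z‖) * √ρ := by ring
      _ ≤ 2 * ρ * √ρ * (K * (1 + ρ) ^ m) * √ρ := by gcongr
      _ = 2 * ρ * (√ρ * √ρ) * (K * (1 + ρ) ^ m) := by ring
      _ = _ := by rw [h6]; ring
  exact le_of_mul_le_mul_left h7 (by positivity)

/-- Cauchy's estimate on |z| = ρ/2 keeps |F^{(n)}(0)| √ρ bounded as ρ grows. The gain √ρ is what
excludes n = m too. -/
theorem iteratedDeriv_eq_zero_of_norm_mul_sqrt_im_le {F : ℂ → ℂ} (hF : Differentiable ℂ F) {K : ℝ}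
    (hK : 0 ≤ K) {m : ℕ} (h : ∀ z : ℂ, z.im ≠ 0 → ‖F z‖ * √|z.im| ≤ K * (1 + ‖z‖) ^ m) {n : ℕ}
    (hn : m ≤ n) : iteratedDeriv n F 0 = 0 := by
  by_contra hne
  have hpos : 0 < ‖iteratedDeriv n F 0‖ := norm_pos_iff.2 hne
  have hb : ∀ ρ : ℝ, 1 ≤ ρ →
      ‖iteratedDeriv n F 0‖ * √ρ ≤ n.factorial * (4 * K * 2 ^ m) * 2 ^ n := by
    intro ρ hρ
    have hρ0 : 0 < ρ := by linarith
    have hs : 0 < √ρ := Real.sqrt_pos.2 hρ0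
    have h1 := Complex.norm_iteratedDeriv_le_of_forall_mem_sphere_norm_le (c := 0) (R := ρ / 2)
      (C := 4 * K * (1 + ρ) ^ m / √ρ) n (by positivity) hF.diffContOnCl (fun z hz => by
        rw [le_div_iff₀ hs]
        exact norm_le_of_norm_mul_sqrt_im_le hF hK h hρ0
          (by rw [mem_sphere_zero_iff_norm] at hz; exact hz.le))
    have h2 : (1 + ρ) ^ m ≤ 2 ^ m * ρ ^ n := by
      calc (1 + ρ) ^ m ≤ (2 * ρ) ^ m := by gcongr; linarith
        _ = 2 ^ m * ρ ^ m := mul_pow _ _ _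
        _ ≤ _ := by gcongr
    calc ‖iteratedDeriv n F 0‖ * √ρ
        ≤ n.factorial * (4 * K * (1 + ρ) ^ m / √ρ) / (ρ / 2) ^ n * √ρ := by gcongr
      _ = n.factorial * (4 * K * (1 + ρ) ^ m) * 2 ^ n / ρ ^ n := by
          rw [div_pow]; field_simp
      _ ≤ n.factorial * (4 * K * (2 ^ m * ρ ^ n)) * 2 ^ n / ρ ^ n := by gcongr
      _ = _ := by field_simp
  set M := n.factorial * (4 * K * 2 ^ m) * 2 ^ n
  have hM : 0 ≤ M := by positivity
  -- This ρ makes the left-hand side M + |F^{(n)}(0)|, which exceeds M.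
  have h3 := hb ((M / ‖iteratedDeriv n F 0‖ + 1) ^ 2) (by
    have : 0 ≤ M / ‖iteratedDeriv n F 0‖ := by positivity
    nlinarith)
  rw [Real.sqrt_sq (by positivity), mul_add, mul_div_cancel₀ _ hpos.ne'] at h3
  linarith

/-- An entire function which is `O(|z|^m / |Im z|^{1/2})` is a polynomial of degree less than
`m`. -/
theorem exists_polynomial_of_norm_mul_sqrt_im_le {F : ℂ → ℂ} (hF : Differentiable ℂ F) {K : ℝ}
    (hK : 0 ≤ K) {m : ℕ} (h : ∀ z : ℂ, z.im ≠ 0 → ‖F z‖ * √|z.im| ≤ K * (1 + ‖z‖) ^ m) :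
    ∃ p : ℂ[X], p.degree < m ∧ F = fun x => p.eval x := by
  refine ⟨∑ n ∈ Finset.range m, monomial n ((n.factorial : ℂ)⁻¹ * iteratedDeriv n F 0), ?_, ?_⟩
  · rw [← mem_degreeLT]
    refine Submodule.sum_mem _ fun n hn => ?_
    rw [mem_degreeLT]
    exact (degree_monomial_le _ _).trans_lt (by exact_mod_cast Finset.mem_range.1 hn)
  · funext z
    rw [← Complex.taylorSeries_eq_of_entire' 0 z hF, tsum_eq_sum (s := Finset.range m),
      eval_finsetSum]
    · simp [eval_monomial]
    · intro n hn
      rw [iteratedDeriv_eq_zero_of_norm_mul_sqrt_im_le hF hK h (by simpa using hn)]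
      simp

/-! ### The Hardy space of the upper half-plane -/

section Hardy

open MeasureTheory Metric Set

/-- The mean value property of g², followed by the triangle inequality. -/
theorem enorm_sq_le_lintegral_circle {g : ℂ → ℂ} {c : ℂ} {r ρ : ℝ}
    (hg : DifferentiableOn ℂ g (ball c ρ)) (hr : 0 < r) (hrρ : r < ρ) :
    ENNReal.ofReal (2 * Real.pi) * ‖g c‖ₑ ^ 2
      ≤ ∫⁻ θ in Ioo (-Real.pi) Real.pi, ‖g (c + Complex.polarCoord.symm (r, θ))‖ₑ ^ 2 := by
  have hd : DiffContOnCl ℂ (fun z => g z ^ 2) (ball c |r|) := by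
    refine (hg.pow 2).diffContOnCl_ball ?_
    rw [abs_of_pos hr]
    exact closedBall_subset_ball hrρ
  have h1 := hd.circleAverage
  rw [Real.circleAverage_eq_integral_add (-Real.pi),
    intervalIntegral.integral_comp_add_right (fun θ => g (circleMap c r θ) ^ 2)] at h1
  have h2 : ∫ θ in (-Real.pi)..Real.pi, g (circleMap c r θ) ^ 2 = (2 * Real.pi : ℝ) • g c ^ 2 := by
    rw [← h1, smul_smul, mul_inv_cancel₀ (by positivity), one_smul]
    congr 1 <;> ring
  rw [intervalIntegral.integral_of_le (by linarith [Real.pi_pos]), integral_Ioc_eq_integral_Ioo]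
    at h2
  have h3 := enorm_integral_le_lintegral_enorm (μ := volume.restrict (Ioo (-Real.pi) Real.pi))
    (fun θ => g (circleMap c r θ) ^ 2)
  rw [h2, enorm_smul, enorm_pow, Real.enorm_of_nonneg (by positivity)] at h3
  refine h3.trans_eq ?_
  refine lintegral_congr fun θ => ?_
  rw [enorm_pow, Complex.polarCoord_symm_apply, circleMap, Complex.exp_mul_I]
  simp

theorem measurable_indicator_enorm_sq {g : ℂ → ℂ} {s : Set ℂ} (hs : IsOpen s)
    (hg : ContinuousOn g s) : Measurable (s.indicator fun z => ‖g z‖ₑ ^ 2) := by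
  classical
  rw [← piecewise_eq_indicator]
  exact ContinuousOn.measurable_piecewise
    ((ENNReal.continuous_pow 2).comp_continuousOn (continuous_enorm.comp_continuousOn hg))
    continuousOn_const hs.measurableSet

/-- Integrates the circle inequality over ρ/2 < r < ρ, where the density r is at least ρ/2; the
constant is (ρ/2) · 2π · (ρ/2) = πρ²/2 ≥ ρ². -/
theorem enorm_sq_mul_le_lintegral_ball {g : ℂ → ℂ} {c : ℂ} {ρ : ℝ} (hρ : 0 < ρ)
    (hg : DifferentiableOn ℂ g (ball c ρ)) :
    ENNReal.ofReal (ρ ^ 2) * ‖g c‖ₑ ^ 2 ≤ ∫⁻ z, (ball c ρ).indicator (fun z => ‖g z‖ₑ ^ 2) z := by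
  have hm := measurable_indicator_enorm_sq isOpen_ball hg.continuousOn
  set H := (ball c ρ).indicator fun z => ‖g z‖ₑ ^ 2 with hH
  have hcont : Continuous fun p : ℝ × ℝ => c + Complex.polarCoord.symm p := by
    simp only [Complex.polarCoord_symm_apply]
    fun_prop
  have hmeas : Measurable fun p : ℝ × ℝ =>
      ENNReal.ofReal p.1 * H (c + Complex.polarCoord.symm p) :=
    (ENNReal.measurable_ofReal.comp measurable_fst).mul (hm.comp hcont.measurable)
  have hpi := Real.pi_gt_three
  calc ENNReal.ofReal (ρ ^ 2) * ‖g c‖ₑ ^ 2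
      ≤ ENNReal.ofReal (ρ / 2) * (ENNReal.ofReal (2 * Real.pi) * ‖g c‖ₑ ^ 2)
          * volume (Ioo (ρ / 2) ρ) := by
        rw [Real.volume_Ioo, ← mul_assoc, mul_right_comm,
          ← ENNReal.ofReal_mul (by positivity), ← ENNReal.ofReal_mul (by positivity)]
        gcongr
        nlinarith [sq_nonneg ρ]
    _ = ∫⁻ _ in Ioo (ρ / 2) ρ,
          ENNReal.ofReal (ρ / 2) * (ENNReal.ofReal (2 * Real.pi) * ‖g c‖ₑ ^ 2) := by
        rw [setLIntegral_const]
    _ ≤ ∫⁻ r in Ioo (ρ / 2) ρ, ∫⁻ θ in Ioo (-Real.pi) Real.pi,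
          ENNReal.ofReal r * H (c + Complex.polarCoord.symm (r, θ)) := by
        refine setLIntegral_mono' measurableSet_Ioo fun r hr => ?_
        have hr0 : 0 < r := by linarith [hr.1]
        rw [lintegral_const_mul' _ _ ENNReal.ofReal_ne_top]
        refine mul_le_mul' (ENNReal.ofReal_le_ofReal hr.1.le) ?_
        refine (enorm_sq_le_lintegral_circle hg hr0 hr.2).trans_eq ?_
        refine lintegral_congr fun θ => ?_
        rw [hH, indicator_of_mem]
        rw [mem_ball_iff_norm, add_sub_cancel_left, Complex.norm_polarCoord_symm, abs_of_pos hr0]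
        exact hr.2
    _ = ∫⁻ p in Ioo (ρ / 2) ρ ×ˢ Ioo (-Real.pi) Real.pi,
          ENNReal.ofReal p.1 * H (c + Complex.polarCoord.symm p) := by
        rw [Measure.volume_eq_prod, ← Measure.prod_restrict, lintegral_prod _ hmeas.aemeasurable]
    _ ≤ ∫⁻ p in polarCoord.target,
          ENNReal.ofReal p.1 * H (c + Complex.polarCoord.symm p) := by
        refine lintegral_mono_set ?_
        exact prod_mono (fun r hr => (by linarith [hr.1] : (0 : ℝ) < r)) subset_rfl
    _ = ∫⁻ z, H z := by
        have h := Complex.lintegral_comp_polarCoord_symm fun z => H (c + z)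
        rw [lintegral_add_left_eq_self H c] at h
        exact h

/-- Fubini by horizontal slices: the disc has height 2ρ. -/
theorem lintegral_ball_le {g : ℂ → ℂ} {c : ℂ} {ρ : ℝ}
    (hg : ContinuousOn g (ball c ρ)) {M : ENNReal}
    (hM : ∀ y ∈ Ioo (c.im - ρ) (c.im + ρ), ∫⁻ x : ℝ, ‖g (x + y * Complex.I)‖ₑ ^ 2 ≤ M) :
    ∫⁻ z, (ball c ρ).indicator (fun z => ‖g z‖ₑ ^ 2) z ≤ M * ENNReal.ofReal (2 * ρ) := by
  have hm : Measurable fun p : ℝ × ℝ => (ball c ρ).indicator (fun z => ‖g z‖ₑ ^ 2)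
      (Complex.measurableEquivRealProd.symm p) :=
    (measurable_indicator_enorm_sq isOpen_ball hg).comp
      Complex.measurableEquivRealProd.symm.measurable
  rw [← Complex.volume_preserving_equiv_real_prod.symm.lintegral_comp_emb
    Complex.measurableEquivRealProd.symm.measurableEmbedding, Measure.volume_eq_prod,
    lintegral_prod_symm _ hm.aemeasurable]
  calc _ ≤ ∫⁻ y, (Ioo (c.im - ρ) (c.im + ρ)).indicator (fun _ => M) y := by
        refine lintegral_mono fun y => ?_
        by_cases hy : y ∈ Ioo (c.im - ρ) (c.im + ρ)
        · rw [indicator_of_mem hy]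
          refine (lintegral_mono fun x => ?_).trans (hM y hy)
          refine (indicator_le_self _ _ _).trans_eq ?_
          rw [Complex.measurableEquivRealProd_symm_apply, Complex.mk_eq_add_mul_I]
        · rw [indicator_of_notMem hy]
          refine le_of_eq ((lintegral_congr fun x => ?_).trans lintegral_zero)
          refine indicator_of_notMem (fun hx => hy ?_) _
          rw [mem_ball_iff_norm, Complex.measurableEquivRealProd_symm_apply] at hx
          have h1 := (Complex.abs_im_le_norm _).trans_lt hx
          rw [Complex.sub_im, abs_lt] at h1
          exact ⟨by linarith [h1.1], by linarith [h1.2]⟩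
    _ = _ := by
        rw [lintegral_indicator_const measurableSet_Ioo, Real.volume_Ioo]
        congr 2
        ring

/-- Functions in the Hardy space `H_2` are `O((Im z)^{-1/2})`. -/
theorem MemHardyH2.exists_norm_mul_sqrt_im_le {f : ℂ → ℂ} (hf : MemHardyH2 f) :
    ∃ K : ℝ, 0 ≤ K ∧ ∀ z : ℂ, 0 < z.im → ‖f z‖ * √z.im ≤ K := by
  obtain ⟨hd, hM⟩ := hf
  set M := ⨆ y : {y : ℝ // 0 < y},
      (∫⁻ x : ℝ, ‖f ((x : ℂ) + ((y : ℝ) : ℂ) * Complex.I)‖ₑ ^ 2)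
  refine ⟨√(2 * M.toReal), by positivity, fun c hc => ?_⟩
  -- The largest disc about c in the half-plane, of radius Im c, gives (Im c)² |f(c)|² ≤ 2 M Im c.
  have hball : ball c c.im ⊆ {z : ℂ | 0 < z.im} := by
    intro z hz
    rw [mem_ball_iff_norm] at hz
    have h1 := (Complex.abs_im_le_norm _).trans_lt hz
    rw [Complex.sub_im, abs_lt] at h1
    show 0 < z.im
    linarith [h1.1]
  have h1 := (enorm_sq_mul_le_lintegral_ball hc (hd.mono hball)).trans
    (lintegral_ball_le (M := M) (hd.mono hball).continuousOn fun y hy =>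
      le_iSup (fun y : {y : ℝ // 0 < y} =>
        (∫⁻ x : ℝ, ‖f ((x : ℂ) + ((y : ℝ) : ℂ) * Complex.I)‖ₑ ^ 2)) ⟨y, by linarith [hy.1]⟩)
  have h2 := ENNReal.toReal_mono (ENNReal.mul_ne_top hM.ne ENNReal.ofReal_ne_top) h1
  rw [ENNReal.toReal_mul, ENNReal.toReal_mul, ENNReal.toReal_ofReal (by positivity),
    ENNReal.toReal_ofReal (by positivity), ENNReal.toReal_pow, toReal_enorm] at h2
  refine Real.le_sqrt_of_sq_le ?_
  rw [mul_pow, Real.sq_sqrt hc.le]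
  refine le_of_mul_le_mul_left ?_ hc
  linarith

/-- On every horizontal line |f|² is dominated by C / (1 + x²), uniformly in the height. -/
theorem memHardyH2_of_norm_sq_mul_le {f : ℂ → ℂ} (hf : DifferentiableOn ℂ f {z : ℂ | 0 < z.im})
    {C : ℝ} (hC : ∀ z : ℂ, 0 < z.im → ‖f z‖ ^ 2 * (1 + ‖z‖ ^ 2) ≤ C) : MemHardyH2 f := by
  refine ⟨hf, lt_of_le_of_lt (iSup_le fun y => ?_)
    (integrable_inv_one_add_sq.const_mul C).lintegral_lt_top⟩
  refine lintegral_mono fun x => ?_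
  have h1 := hC (x + (y : ℝ) * Complex.I) (by simpa using y.2)
  have h2 : x ^ 2 ≤ ‖(x + (y : ℝ) * Complex.I : ℂ)‖ ^ 2 := by
    rw [← sq_abs x]
    refine pow_le_pow_left₀ (abs_nonneg _) ?_ 2
    simpa using Complex.abs_re_le_norm (x + (y : ℝ) * Complex.I : ℂ)
  rw [← ofReal_norm, ← ENNReal.ofReal_pow (norm_nonneg _)]
  refine ENNReal.ofReal_le_ofReal ?_
  rw [← div_eq_mul_inv, le_div_iff₀ (by positivity)]
  refine le_trans ?_ h1
  gcongr

end Hardy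

/-! ### De Branges spaces of polynomials -/

theorem sharp_eval (p : ℂ[X]) :
    sharp (fun x => p.eval x) = fun x => (p.map (starRingEnd ℂ)).eval x := by
  funext x
  have h := Polynomial.eval_map_apply (starRingEnd ℂ) (p := p) (conj x)
  rw [Complex.conj_conj] at h
  exact h.symm

theorem memHardyH2_rational {P D : ℂ[X]} (hdeg : P.degree < D.degree)
    (hD : ∀ z : ℂ, 0 ≤ z.im → D.eval z ≠ 0) : MemHardyH2 fun z => P.eval z / D.eval z := by
  obtain ⟨C, -, hC⟩ := exists_norm_sq_eval_mul_le hdeg hD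
  refine memHardyH2_of_norm_sq_mul_le (C := C) ?_ fun z hz => ?_
  · exact P.differentiable.differentiableOn.div D.differentiable.differentiableOn
      fun z hz => hD z (le_of_lt hz)
  · rw [norm_div, div_pow, div_mul_eq_mul_div,
      div_le_iff₀ (pow_pos (norm_pos_iff.2 (hD z hz.le)) 2)]
    exact hC z hz.le

theorem exists_norm_eval_le_mul_pow (D : ℂ[X]) :
    ∃ C : ℝ, 0 ≤ C ∧ ∀ z : ℂ, ‖D.eval z‖ ≤ C * (1 + ‖z‖) ^ D.natDegree := by
  refine ⟨∑ i ∈ Finset.range (D.natDegree + 1), ‖D.coeff i‖, by positivity, fun z => ?_⟩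
  rw [eval_eq_sum_range, Finset.sum_mul]
  refine (norm_sum_le _ _).trans (Finset.sum_le_sum fun i hi => ?_)
  rw [norm_mul, norm_pow]
  gcongr
  calc ‖z‖ ^ i ≤ (1 + ‖z‖) ^ i := by gcongr; linarith
    _ ≤ _ := pow_le_pow_right₀ (by linarith [norm_nonneg z])
      (by have := Finset.mem_range.1 hi; omega)

/-- The de Branges space of a polynomial `E` of degree `n` without zeros in the closed upper
half-plane consists of the polynomials of degree less than `n`. -/
theorem deBrangesSet_polynomial {E : ℂ[X]} {n : ℕ} (hdeg : E.degree = n)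
    (hE : ∀ z : ℂ, 0 ≤ z.im → E.eval z ≠ 0) :
    deBrangesSet (fun x => E.eval x) = {F | ∃ p : ℂ[X], p.degree < n ∧ F = fun x => p.eval x} := by
  ext F
  constructor
  · rintro ⟨hF, h1, h2⟩
    obtain ⟨K, hK0, hK⟩ := h1.exists_norm_mul_sqrt_im_le
    obtain ⟨K', hK0', hK'⟩ := h2.exists_norm_mul_sqrt_im_le
    obtain ⟨C, hC0, hC⟩ := exists_norm_eval_le_mul_pow E
    have hn : E.natDegree = n := natDegree_eq_of_degree_eq_some hdeg
    rw [hn] at hC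
    have key : ∀ G : ℂ → ℂ, ∀ L : ℝ, 0 ≤ L → (∀ z : ℂ, 0 < z.im → ‖G z / E.eval z‖ * √z.im ≤ L) →
        ∀ z : ℂ, 0 < z.im → ‖G z‖ * √z.im ≤ L * C * (1 + ‖z‖) ^ n := by
      intro G L hL hG z hz
      have h3 := hG z hz
      have h4 : 0 < ‖E.eval z‖ := norm_pos_iff.2 (hE z hz.le)
      rw [norm_div, div_mul_eq_mul_div, div_le_iff₀ h4] at h3
      rw [mul_assoc]
      exact h3.trans (mul_le_mul_of_nonneg_left (hC z) hL)
    refine exists_polynomial_of_norm_mul_sqrt_im_le hF (K := (K + K') * C) (by positivity)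
      fun z hz => ?_
    rcases lt_or_gt_of_ne hz with h | h
    -- Below the axis the bound comes from F^# / E at conj z.
    · have h5 := key _ K' hK0' hK' (conj z) (by simpa using h)
      simp only [sharp, Complex.conj_conj, RCLike.norm_conj, Complex.conj_im] at h5
      rw [abs_of_neg h]
      refine h5.trans ?_
      gcongr
      linarith
    · rw [abs_of_pos h]
      refine (key _ K hK0 hK z h).trans ?_
      gcongr
      linarith
  · rintro ⟨p, hp, rfl⟩
    rw [← hdeg] at hp
    refine ⟨p.differentiable, memHardyH2_rational hp hE, ?_⟩
    rw [sharp_eval]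
    exact memHardyH2_rational (by rwa [degree_map]) hE

/-! ### The Hermite–Biehler polynomial of a Jacobi matrix -/

/-- The polynomial `φ_n - i a_n φ_{n+1}`. -/
noncomputable def jacobiE (a b : ℕ → ℝ) (n : ℕ) : ℂ[X] :=
  (jacobiPoly a b n).map (algebraMap ℝ ℂ)
    - C (Complex.I * a n) * (jacobiPoly a b (n + 1)).map (algebraMap ℝ ℂ)

theorem eval_jacobiE (a b : ℕ → ℝ) (n : ℕ) (x : ℂ) :
    (jacobiE a b n).eval x = jacobiPhi a b n x - Complex.I * a n * jacobiPhi a b (n + 1) x := by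
  simp only [jacobiE, eval_sub, eval_mul, eval_C, eval_map_algebraMap, aeval_jacobiPoly]

theorem conj_eval_jacobiE (a b : ℕ → ℝ) (n : ℕ) (x : ℂ) :
    conj ((jacobiE a b n).eval x)
      = jacobiPhi a b n (conj x) + Complex.I * a n * jacobiPhi a b (n + 1) (conj x) := by
  rw [eval_jacobiE]
  simp [conj_jacobiPhi]

theorem degree_jacobiE {a : ℕ → ℝ} (b : ℕ → ℝ) (ha : ∀ n, 0 < a n) (n : ℕ) :
    (jacobiE a b n).degree = n := by
  have h1 : (C (Complex.I * a n) * (jacobiPoly a b (n + 1)).map (algebraMap ℝ ℂ)).degree = n := by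
    rw [degree_C_mul (mul_ne_zero Complex.I_ne_zero (by exact_mod_cast (ha n).ne')), degree_map,
      degree_jacobiPoly b ha]
  rw [jacobiE, degree_sub_eq_right_of_degree_lt, h1]
  rw [h1, degree_map]
  rcases n with _ | n
  · simp [jacobiPoly]
  · rw [degree_jacobiPoly b ha]
    exact_mod_cast n.lt_succ_self

/-- With E = A - iB, where A = φ_n and B = a_n φ_{n+1} are real, the right-hand side is 2i (B(conj
z) A(x) - A(conj z) B(x)), the Christoffel–Darboux numerator at x and conj z. -/
theorem sum_conj_jacobiPhi_mul {a : ℕ → ℝ} (b : ℕ → ℝ) (ha : ∀ n, 0 < a n) (n : ℕ) (z x : ℂ) :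
    2 * Complex.I * (conj z - x)
        * ∑ k ∈ Finset.Icc 1 n, conj (jacobiPhi a b k z) * jacobiPhi a b k x
      = conj ((jacobiE a b n).eval z) * (jacobiE a b n).eval x
        - (jacobiE a b n).eval (conj z) * conj ((jacobiE a b n).eval (conj x)) := by
  have h := christoffel_darboux b ha x (conj z) n
  simp only [conj_jacobiPhi, conj_eval_jacobiE, Complex.conj_conj]
  simp only [eval_jacobiE]
  linear_combination (-2 * Complex.I) * h

theorem norm_sq_jacobiE_sub {a : ℕ → ℝ} (b : ℕ → ℝ) (ha : ∀ n, 0 < a n) (n : ℕ) (z : ℂ) :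
    ‖(jacobiE a b n).eval z‖ ^ 2 - ‖(jacobiE a b n).eval (conj z)‖ ^ 2
      = 4 * z.im * ∑ k ∈ Finset.Icc 1 n, ‖jacobiPhi a b k z‖ ^ 2 := by
  have h := sum_conj_jacobiPhi_mul b ha n z z
  have h2 : conj z - z = -(2 * Complex.I * z.im) := by
    rw [← neg_sub, Complex.sub_conj]; push_cast; ring
  simp only [Complex.conj_mul', Complex.mul_conj', h2] at h
  have h3 : ((‖(jacobiE a b n).eval z‖ ^ 2 - ‖(jacobiE a b n).eval (conj z)‖ ^ 2 : ℝ) : ℂ)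
      = ((4 * z.im * ∑ k ∈ Finset.Icc 1 n, ‖jacobiPhi a b k z‖ ^ 2 : ℝ) : ℂ) := by
    push_cast
    rw [← h]
    linear_combination (-4 * z.im * ∑ k ∈ Finset.Icc 1 n, (‖jacobiPhi a b k z‖ : ℂ) ^ 2)
      * Complex.I_sq
  exact_mod_cast h3

theorem isHermiteBiehler_jacobiE {a : ℕ → ℝ} (b : ℕ → ℝ) (ha : ∀ n, 0 < a n) {n : ℕ}
    (hn : 1 ≤ n) : IsHermiteBiehler fun x => (jacobiE a b n).eval x := by
  refine ⟨(jacobiE a b n).differentiable, fun z hz => ?_⟩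
  have h := norm_sq_jacobiE_sub b ha n z
  -- The term k = 1 is |φ_1|² = 1.
  have h1 : (1 : ℝ) ≤ ∑ k ∈ Finset.Icc 1 n, ‖jacobiPhi a b k z‖ ^ 2 := by
    refine le_trans (le_of_eq ?_) (Finset.single_le_sum
      (f := fun k => ‖jacobiPhi a b k z‖ ^ 2) (fun _ _ => by positivity)
      (Finset.mem_Icc.2 ⟨le_rfl, hn⟩))
    simp [jacobiPhi]
  refine lt_of_pow_lt_pow_left₀ 2 (norm_nonneg _) ?_
  nlinarith

/-- A real zero of E would be a common zero of φ_n and φ_{n+1}. -/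
theorem jacobiE_ne_zero {a : ℕ → ℝ} (b : ℕ → ℝ) (ha : ∀ n, 0 < a n) {n : ℕ}
    (hn : 1 ≤ n) (z : ℂ) (hz : 0 ≤ z.im) : (jacobiE a b n).eval z ≠ 0 := by
  rcases hz.lt_or_eq with hz | hz
  · have h := (isHermiteBiehler_jacobiE b ha hn).2 z hz
    exact norm_pos_iff.1 ((norm_nonneg _).trans_lt h)
  · intro h0
    have hzc : conj z = z := Complex.conj_eq_iff_im.2 hz.symm
    have h1 := conj_eval_jacobiE a b n z
    rw [h0, map_zero, hzc] at h1
    rw [eval_jacobiE] at h0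
    have h2 : jacobiPhi a b n z = 0 := by linear_combination (h0 - h1) / 2
    have h3 : Complex.I * a n * jacobiPhi a b (n + 1) z = 0 := by linear_combination -(h0 + h1) / 2
    have h4 : (a n : ℂ) ≠ 0 := by exact_mod_cast (ha n).ne'
    have h5 : jacobiPhi a b (n + 1) z = 0 := by simpa [h4] using h3
    exact (jacobiPhi_ne_zero_or b ha z n).elim (· h2) (· h5)

/-! ### Orthogonality with respect to `dx / |E|²` -/

open MeasureTheory

theorem integrable_deBrangesIntegrand {P G E : ℂ[X]} (hP : P.degree < E.degree)
    (hG : G.degree < E.degree) (hE : ∀ z : ℂ, 0 ≤ z.im → E.eval z ≠ 0) :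
    Integrable (deBrangesIntegrand (fun x => E.eval x) (fun x => P.eval x) fun x => G.eval x) := by
  obtain ⟨c, hc0, hc⟩ := exists_norm_sq_eval_mul_le hP hE
  obtain ⟨d, hd0, hd⟩ := exists_norm_sq_eval_mul_le hG hE
  refine (integrable_inv_one_add_sq.const_mul (c + d)).mono' ?_ ?_
  · refine Continuous.aestronglyMeasurable ?_
    refine Continuous.div ?_ ?_ fun x => ?_
    · exact (Complex.continuous_conj.comp (P.continuous.comp Complex.continuous_ofReal)).mul
        (G.continuous.comp Complex.continuous_ofReal)
    · exact Complex.continuous_ofReal.comp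
        ((E.continuous.comp Complex.continuous_ofReal).norm.pow 2)
    · exact_mod_cast pow_ne_zero 2 (norm_ne_zero_iff.2 (hE x (by simp)))
  · refine Filter.Eventually.of_forall fun x => ?_
    have h1 := hc x (by simp)
    have h2 := hd x (by simp)
    have hpos : 0 < ‖E.eval (x : ℂ)‖ ^ 2 := pow_pos (norm_pos_iff.2 (hE x (by simp))) 2
    simp only [Complex.norm_real, Real.norm_eq_abs, sq_abs] at h1 h2
    rw [deBrangesIntegrand, norm_div, norm_mul, RCLike.norm_conj, Complex.norm_real,
      Real.norm_of_nonneg hpos.le, div_le_iff₀ hpos, mul_right_comm, ← div_eq_mul_inv,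
      le_div_iff₀ (by positivity)]
    have h3 : 2 * (‖P.eval (x : ℂ)‖ * ‖G.eval (x : ℂ)‖)
        ≤ ‖P.eval (x : ℂ)‖ ^ 2 + ‖G.eval (x : ℂ)‖ ^ 2 := by
      linarith [two_mul_le_add_sq ‖P.eval (x : ℂ)‖ ‖G.eval (x : ℂ)‖]
    have h4 := mul_le_mul_of_nonneg_right h3 (by positivity : 0 ≤ 1 + x ^ 2)
    have h5 : 0 ≤ ‖P.eval (x : ℂ)‖ * ‖G.eval (x : ℂ)‖ * (1 + x ^ 2) := by positivity
    linarith

/-- The kernel `∑ φ_k(w) φ_k(x)` reproduces the value at `w` of polynomials of degree less than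
`n`. -/
theorem integral_sum_jacobiPhi_mul {a : ℕ → ℝ} (b : ℕ → ℝ) (ha : ∀ n, 0 < a n) {n : ℕ}
    (hn : 1 ≤ n) {G : ℂ[X]} (hG : G.degree < n) {w : ℂ} (hw : 0 < w.im) :
    ∫ x : ℝ, (∑ k ∈ Finset.Icc 1 n, jacobiPhi a b k w * jacobiPhi a b k x) * G.eval (x : ℂ)
        / ((‖(jacobiE a b n).eval (x : ℂ)‖ ^ 2 : ℝ) : ℂ) = Real.pi * G.eval w := by
  set E := jacobiE a b n with hEdef
  have hE : ∀ z : ℂ, 0 ≤ z.im → E.eval z ≠ 0 := fun z hz => jacobiE_ne_zero b ha hn z hz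
  have hdeg : G.degree < E.degree := by rwa [hEdef, degree_jacobiE b ha]
  obtain ⟨hA, hA'⟩ := integral_cauchy_rational hdeg hE hw
  set D := (X - C (conj w)) * E with hDdef
  set H := G.map (starRingEnd ℂ) with hHdef
  have hD : ∀ z : ℂ, 0 ≤ z.im → D.eval z ≠ 0 := by
    intro z hz
    simp only [hDdef, eval_mul, eval_C, eval_sub, eval_X]
    refine mul_ne_zero (sub_ne_zero.2 ?_) (hE z hz)
    rintro rfl
    rw [Complex.conj_im] at hz
    linarith
  have hdegD : H.degree + 2 ≤ D.degree := by
    rw [hDdef, degree_mul, degree_X_sub_C, hHdef, degree_map]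
    calc G.degree + 2 = 1 + (G.degree + 1) := by rw [add_comm 1, add_assoc]; norm_num
      _ ≤ _ := by gcongr; exact withBot_add_one_le_of_lt hdeg
  have hB := integrable_rational hdegD hD
  have hB' := integral_rational_eq_zero hdegD hD
  have hBc : Integrable fun x : ℝ => conj (H.eval (x : ℂ) / D.eval (x : ℂ)) :=
    (LinearIsometryEquiv.integrable_comp_iff Complex.conjLIE).2 hB
  -- On the real line |E|² = E conj E, so the kernel formula splits the integrand in two. One part
  -- is the Cauchy integrand of G / E at w. The other is a multiple of the conjugate of G^# / ((x -
  -- conj w) E), which has no poles in the closed upper half-plane and integrates to zero.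
  have key : ∀ x : ℝ, (∑ k ∈ Finset.Icc 1 n, jacobiPhi a b k w * jacobiPhi a b k x)
        * G.eval (x : ℂ) / ((‖E.eval (x : ℂ)‖ ^ 2 : ℝ) : ℂ)
      = E.eval w / (2 * Complex.I) * (G.eval (x : ℂ) / (E.eval (x : ℂ) * (x - w)))
        - conj (E.eval (conj w)) / (2 * Complex.I) * conj (H.eval (x : ℂ) / D.eval (x : ℂ)) := by
    intro x
    have h1 := sum_conj_jacobiPhi_mul b ha n (conj w) x
    simp only [conj_jacobiPhi, Complex.conj_conj, Complex.conj_ofReal] at h1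
    rw [← hEdef] at h1
    have hx := hE x (by simp)
    have hx' : conj (E.eval (x : ℂ)) ≠ 0 := (_root_.map_ne_zero _).2 hx
    have hxw : (x : ℂ) - w ≠ 0 := fun h => by
      have := congrArg Complex.im h; simp at this; linarith
    have h2 : conj (H.eval (x : ℂ)) = G.eval (x : ℂ) := by
      have := congrFun (sharp_eval H) x
      simp only [sharp, Complex.conj_ofReal] at this
      rw [this, hHdef, Polynomial.map_map]
      simp
    have h3 : ((‖E.eval (x : ℂ)‖ ^ 2 : ℝ) : ℂ) = E.eval (x : ℂ) * conj (E.eval (x : ℂ)) := by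
      rw [Complex.mul_conj']; push_cast; rfl
    rw [map_div₀, h2, h3]
    simp only [hDdef, eval_mul, eval_sub, eval_X, eval_C, map_mul, map_sub, Complex.conj_ofReal,
      Complex.conj_conj]
    have hI := Complex.I_ne_zero
    field_simp
    linear_combination (-G.eval (x : ℂ)) * h1
  rw [integral_congr_ae (Filter.Eventually.of_forall key)]
  refine (integral_sub (hA.const_mul _) (hBc.const_mul _)).trans ?_
  rw [integral_const_mul, integral_const_mul, hA', integral_conj, hB', map_zero, mul_zero, sub_zero]
  have hI := Complex.I_ne_zero
  have hEw := hE w hw.le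
  field_simp

theorem sum_Icc_one_eq_sum_fin (T : ℕ) (f : ℕ → ℂ) :
    ∑ n ∈ Finset.Icc 1 T, f n = ∑ i : Fin T, f (i + 1) := by
  rw [Fin.sum_univ_eq_sum_range (fun n => f (n + 1)), Finset.range_eq_Ico,
    Finset.sum_Ico_add' f 0 T 1]
  rfl

/-- Needed because the reproducing identity is obtained only for Im w > 0; polynomials agreeing
there coincide. -/
theorem eq_of_fourierState_eq_on_upperHalfPlane {a : ℕ → ℝ} (b : ℕ → ℝ) (ha : ∀ n, 0 < a n) {T : ℕ}
    {h k : EuclideanSpace ℂ (Fin T)}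
    (hhk : ∀ w : ℂ, 0 < w.im → fourierState a b T h w = fourierState a b T k w) : h = k := by
  apply fourierState_injective b ha T
  simp only [fourierState_eq_eval b ha] at hhk ⊢
  rw [Polynomial.eq_of_infinite_eval_eq _ _ (Set.Infinite.mono (s := {w : ℂ | 0 < w.im}) hhk ?_)]
  refine Set.infinite_of_injective_forall_mem (f := fun n : ℕ => ((n : ℂ) + Complex.I)) ?_ ?_
  · intro m n hmn
    simpa using hmn
  · intro n
    simp

theorem fourierState_polynomial {a : ℕ → ℝ} (b : ℕ → ℝ) (ha : ∀ n, 0 < a n) {T : ℕ}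
    (h : EuclideanSpace ℂ (Fin T)) :
    ∃ p : ℂ[X], p.degree < T ∧ fourierState a b T h = fun x => p.eval x :=
  ⟨_, degree_sum_jacobiSequence_lt b ha T _, fourierState_eq_eval b ha T h⟩

theorem integrable_deBrangesIntegrand_fourierState {a : ℕ → ℝ} (b : ℕ → ℝ) (ha : ∀ n, 0 < a n)
    {T : ℕ} (hT : 1 ≤ T) (h k : EuclideanSpace ℂ (Fin T)) :
    Integrable (deBrangesIntegrand (fun x => (jacobiE a b T).eval x)
      (fourierState a b T h) (fourierState a b T k)) := by
  obtain ⟨p, hp, hp'⟩ := fourierState_polynomial b ha h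
  obtain ⟨q, hq, hq'⟩ := fourierState_polynomial b ha k
  rw [hp', hq']
  rw [← degree_jacobiE b ha] at hp hq
  exact integrable_deBrangesIntegrand hp hq (jacobiE_ne_zero b ha hT)

theorem fourierState_single (a b : ℕ → ℝ) {T : ℕ} (i : Fin T) :
    fourierState a b T (EuclideanSpace.single i 1) = jacobiPhi a b (i + 1) := by
  funext x
  simp [fourierState]

/-- The Fourier transform is an isometry onto a subspace of `L²(dx / (π |E|²))`. -/
theorem deBrangesInner_fourierState {a : ℕ → ℝ} (b : ℕ → ℝ) (ha : ∀ n, 0 < a n)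
    {T : ℕ} (hT : 1 ≤ T) (h k : EuclideanSpace ℂ (Fin T)) :
    deBrangesInner (fun x => (jacobiE a b T).eval x)
      (fourierState a b T h) (fourierState a b T k) = inner ℂ h k := by
  have hpi : (Real.pi : ℂ) ≠ 0 := by exact_mod_cast Real.pi_ne_zero
  have hint : ∀ i : Fin T, Integrable (deBrangesIntegrand (fun x => (jacobiE a b T).eval x)
      (jacobiPhi a b (i + 1)) (fourierState a b T k)) := fun i => by
    rw [← fourierState_single a b i]
    exact integrable_deBrangesIntegrand_fourierState b ha hT _ _
  -- The reproducing identity reads ∑ ⟨φ_n, G⟩ φ_n(w) = G(w); comparing coefficients gives ⟨φ_n, G⟩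
  -- = k_n.
  have hk : (WithLp.toLp 2 fun i : Fin T => deBrangesInner (fun x => (jacobiE a b T).eval x)
      (jacobiPhi a b (i + 1)) (fourierState a b T k) : EuclideanSpace ℂ (Fin T)) = k := by
    refine eq_of_fourierState_eq_on_upperHalfPlane b ha fun w hw => ?_
    obtain ⟨q, hq, hq'⟩ := fourierState_polynomial b ha k
    have h1 := integral_sum_jacobiPhi_mul b ha hT hq hw
    have h2 : ∀ x : ℝ, (∑ n ∈ Finset.Icc 1 T, jacobiPhi a b n w * jacobiPhi a b n x)
          * q.eval (x : ℂ) / ((‖(jacobiE a b T).eval (x : ℂ)‖ ^ 2 : ℝ) : ℂ)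
        = ∑ i : Fin T, jacobiPhi a b (i + 1) w * deBrangesIntegrand
          (fun x => (jacobiE a b T).eval x) (jacobiPhi a b (i + 1)) (fourierState a b T k) x := by
      intro x
      rw [sum_Icc_one_eq_sum_fin, Finset.sum_mul, Finset.sum_div]
      refine Finset.sum_congr rfl fun i _ => ?_
      rw [deBrangesIntegrand, conj_jacobiPhi, Complex.conj_ofReal, hq']
      ring
    rw [integral_congr_ae (Filter.Eventually.of_forall h2),
      integral_finsetSum _ fun i _ => (hint i).const_mul _] at h1
    simp only [integral_const_mul] at h1
    have h3 : fourierState a b T k w = q.eval w := congrFun hq' w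
    rw [h3]
    refine mul_left_cancel₀ hpi (Eq.trans ?_ h1)
    simp only [fourierState, LinearMap.coe_mk, AddHom.coe_mk, deBrangesInner, Finset.mul_sum]
    refine Finset.sum_congr rfl fun i _ => ?_
    field_simp
  have h4 : ∀ x : ℝ, deBrangesIntegrand (fun x => (jacobiE a b T).eval x)
      (fourierState a b T h) (fourierState a b T k) x = ∑ i : Fin T, conj (h i) *
        deBrangesIntegrand (fun x => (jacobiE a b T).eval x) (jacobiPhi a b (i + 1))
          (fourierState a b T k) x := by
    intro x
    have h5 : fourierState a b T h x = ∑ i : Fin T, h i * jacobiPhi a b (i + 1) x := rfl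
    simp only [deBrangesIntegrand, h5, map_sum, map_mul, Finset.sum_mul, Finset.sum_div]
    refine Finset.sum_congr rfl fun i _ => ?_
    ring
  rw [deBrangesInner, integral_congr_ae (Filter.Eventually.of_forall h4),
    integral_finsetSum _ fun i _ => (hint i).const_mul _, PiLp.inner_apply, Finset.mul_sum]
  refine Finset.sum_congr rfl fun i _ => ?_
  have h6 := congrArg (fun v : EuclideanSpace ℂ (Fin T) => v i) hk
  simp only [deBrangesInner] at h6
  rw [integral_const_mul, ← h6, RCLike.inner_apply]
  ring

/-! ### The main theorem -/

/-- The inner product transported along a linear equivalence. -/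
@[reducible]
noncomputable def innerCoreOfLinearEquiv {V W : Type*} [NormedAddCommGroup V]
    [InnerProductSpace ℂ V] [AddCommGroup W] [Module ℂ W] (e : V ≃ₗ[ℂ] W) :
    InnerProductSpace.Core ℂ W where
  inner F G := inner ℂ (e.symm F) (e.symm G)
  conj_inner_symm F G := inner_conj_symm _ _
  re_inner_nonneg F := inner_self_nonneg
  add_left F G H := by rw [map_add, inner_add_left]
  smul_left F G c := by rw [map_smul, inner_smul_left]
  definite F hF := by simpa using hF

/-- The Fourier transform as an equivalence of `ℂ^T` and the space `B_A^T`. -/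
noncomputable def fourierEquiv {a : ℕ → ℝ} (b : ℕ → ℝ) (ha : ∀ n, 0 < a n) (ha0 : a 0 = 1)
    (T : ℕ) : EuclideanSpace ℂ (Fin T) ≃ₗ[ℂ] reachableFourier a b T :=
  (LinearEquiv.ofInjective _ (fourierState_injective b ha T)).trans
    (LinearEquiv.ofEq _ _ (reachableFourier_eq_range b ha ha0 T).symm)

theorem coe_fourierEquiv {a : ℕ → ℝ} (b : ℕ → ℝ) (ha : ∀ n, 0 < a n) (ha0 : a 0 = 1)
    (T : ℕ) (h : EuclideanSpace ℂ (Fin T)) :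
    (fourierEquiv b ha ha0 T h : ℂ → ℂ) = fourierState a b T h := rfl

theorem fourierEquiv_symm_eq {a : ℕ → ℝ} (b : ℕ → ℝ) (ha : ∀ n, 0 < a n) (ha0 : a 0 = 1)
    {T : ℕ} {F : reachableFourier a b T} {f : EuclideanSpace ℂ (Fin T)}
    (hF : (F : ℂ → ℂ) = chebyshevSum T f) :
    (fourierEquiv b ha ha0 T).symm F = controlOp a b T (reversal T f) := by
  rw [LinearEquiv.symm_apply_eq]
  apply Subtype.ext
  rw [hF, coe_fourierEquiv, fourierState_controlOp_reversal b ha ha0]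

/-- This turns the Krein equation into the Riesz representation of evaluation at z. -/
theorem inner_kreinRHS (T : ℕ) (z : ℂ) (f : EuclideanSpace ℂ (Fin T)) :
    inner ℂ (kreinRHS T z) f = chebyshevSum T f z := by
  simp [kreinRHS, chebyshevSum, PiLp.inner_apply, mul_comm]

/-- The solution of the Krein equation is the control which leads to the state
`(conj φ_1(z), …, conj φ_T(z))`. -/
theorem controlOp_reversal_krein {a : ℕ → ℝ} (b : ℕ → ℝ) (ha : ∀ n, 0 < a n) (ha0 : a 0 = 1)
    {T : ℕ} {z : ℂ} {j : EuclideanSpace ℂ (Fin T)}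
    (hj : connectingOpRev a b T j = kreinRHS T z) (i : Fin T) :
    controlOp a b T (reversal T j) i = conj (jacobiPhi a b (i + 1) z) := by
  -- Test against the control steering to the i-th basis vector: its function is φ_{i+1}.
  obtain ⟨f, hf⟩ := controlOp_reversal_surjective b ha ha0 T (EuclideanSpace.single i 1)
  have h1 := inner_connectingOpRev a b T j f
  rw [hj, inner_kreinRHS, ← fourierState_controlOp_reversal b ha ha0] at h1
  rw [LinearMap.comp_apply] at hf
  rw [hf, fourierState_single, EuclideanSpace.inner_single_right, one_mul] at h1
  rw [h1, Complex.conj_conj]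

theorem mainTheorem9 (a b : ℕ → ℝ) (ha : ∀ n, 0 < a n) (ha0 : a 0 = 1) (T : ℕ) (hT : 1 ≤ T) :
    -- the Fourier images of the reachable states, in terms of the controls
    (∀ f : EuclideanSpace ℂ (Fin T),
      fourierState a b T (controlOp a b T (reversal T f)) = chebyshevSum T f) ∧
    (reachableFourier a b T : Set (ℂ → ℂ)) = Set.range (chebyshevSum T) ∧
    -- the states of the system on `1, …, T` at time `T` give the same functions
    (∀ f : EuclideanSpace ℂ (Fin T), controlOpFin a b T T f = controlOp a b T f) ∧
    (reachableFourier a b T : Set (ℂ → ℂ)) =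
      {F | ∃ f : EuclideanSpace ℂ (Fin T), F = fourierState a b T (controlOpFin a b T T f)} ∧
    -- they are the polynomials of degree at most `T - 1`
    (reachableFourier a b T : Set (ℂ → ℂ)) =
      {F | ∃ p : Polynomial ℂ, p.degree < T ∧ F = fun x => p.eval x} ∧
    -- the real polynomials among them come from the real controls
    (∀ f : EuclideanSpace ℂ (Fin T),
      (∃ p : Polynomial ℝ, p.degree < T ∧ ∀ x : ℂ, chebyshevSum T f x = Polynomial.aeval x p) ↔
        ∀ i, (f i).im = 0) ∧
    -- `(C_T f, g)` is a well defined inner product, which makes a de Branges space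
    Function.Injective (chebyshevSum T) ∧
    ∃ ip : InnerProductSpace.Core ℂ (reachableFourier a b T),
      (∀ (F G : reachableFourier a b T) (f g : EuclideanSpace ℂ (Fin T)),
        (F : ℂ → ℂ) = chebyshevSum T f → (G : ℂ → ℂ) = chebyshevSum T g →
          ip.inner F G = inner ℂ (connectingOpRev a b T f) g) ∧
      ∃ E : ℂ → ℂ, IsDeBrangesSpaceOf (reachableFourier a b T) ip E ∧
        -- its reproducing kernel, through the Krein equation
        ∀ z : ℂ,
          (∃! j : EuclideanSpace ℂ (Fin T), connectingOpRev a b T j = kreinRHS T z) ∧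
          ∀ j : EuclideanSpace ℂ (Fin T), connectingOpRev a b T j = kreinRHS T z →
            ∃ J : reachableFourier a b T, (J : ℂ → ℂ) = chebyshevSum T j ∧
              (∀ F : reachableFourier a b T, ip.inner J F = (F : ℂ → ℂ) z) ∧
              (∀ x : ℂ, x ≠ conj z → (J : ℂ → ℂ) x = deBrangesKernel E z x) ∧
              ∀ x : ℂ, (J : ℂ → ℂ) x =
                ∑ n ∈ Finset.Icc 1 T, conj (jacobiPhi a b n z) * jacobiPhi a b n x := by
  have hrange : (reachableFourier a b T : Set (ℂ → ℂ)) = Set.range (chebyshevSum T) := by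
    ext F
    constructor
    · rintro ⟨f, rfl⟩
      exact ⟨f, (fourierState_controlOp_reversal b ha ha0 T f).symm⟩
    · rintro ⟨f, rfl⟩
      exact ⟨f, fourierState_controlOp_reversal b ha ha0 T f⟩
  have hpoly := hrange.trans (range_chebyshevSum T)
  -- The inner product is that of the states, carried over by the Fourier transform; E is φ_T - i
  -- a_T φ_{T+1}.
  refine ⟨fourierState_controlOp_reversal b ha ha0 T, hrange, controlOpFin_eq_controlOp a b T,
    ?_, hpoly, chebyshevSum_real_iff T, chebyshevSum_injective T,
    innerCoreOfLinearEquiv (fourierEquiv b ha ha0 T), ?_,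
    fun x => (jacobiE a b T).eval x, ⟨isHermiteBiehler_jacobiE b ha hT, ?_, ?_⟩, fun z => ⟨?_, ?_⟩⟩
  · ext F
    constructor
    · rintro ⟨f, rfl⟩
      exact ⟨reversal T f, by rw [controlOpFin_eq_controlOp]; rfl⟩
    · rintro ⟨f, rfl⟩
      refine ⟨reversal T f, ?_⟩
      rw [controlOpFin_eq_controlOp, LinearMap.comp_apply, LinearMap.comp_apply,
        reversal_reversal]
  · intro F G f g hF hG
    rw [inner_connectingOpRev, ← fourierEquiv_symm_eq b ha ha0 hF,
      ← fourierEquiv_symm_eq b ha ha0 hG]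
    rfl
  · rw [hpoly, deBrangesSet_polynomial (degree_jacobiE b ha T) (jacobiE_ne_zero b ha hT)]
  · intro F G
    obtain ⟨h, rfl⟩ := (fourierEquiv b ha ha0 T).surjective F
    obtain ⟨k, rfl⟩ := (fourierEquiv b ha ha0 T).surjective G
    refine ⟨integrable_deBrangesIntegrand_fourierState b ha hT h k, ?_⟩
    rw [coe_fourierEquiv, coe_fourierEquiv, deBrangesInner_fourierState b ha hT]
    change inner ℂ ((fourierEquiv b ha ha0 T).symm _) ((fourierEquiv b ha ha0 T).symm _) = _
    rw [LinearEquiv.symm_apply_apply, LinearEquiv.symm_apply_apply]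
  · exact (connectingOpRev_bijective b ha ha0 T).existsUnique _
  · intro j hj
    have hJ := fourierState_controlOp_reversal b ha ha0 T j
    have hsum : ∀ x : ℂ, chebyshevSum T j x
        = ∑ n ∈ Finset.Icc 1 T, conj (jacobiPhi a b n z) * jacobiPhi a b n x := by
      intro x
      rw [← hJ, sum_Icc_one_eq_sum_fin T fun n => conj (jacobiPhi a b n z) * jacobiPhi a b n x]
      change ∑ i : Fin T, _ * jacobiPhi a b (i + 1) x = _
      exact Finset.sum_congr rfl fun i _ => by rw [controlOp_reversal_krein b ha ha0 hj]
    refine ⟨fourierEquiv b ha ha0 T (controlOp a b T (reversal T j)), hJ, fun F => ?_,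
      fun x hx => ?_, fun x => ?_⟩
    · obtain ⟨f, hf⟩ := (Set.ext_iff.1 hrange (F : ℂ → ℂ)).1 F.2
      -- F(z) = (C_T j, f) is the inner product of the states of j and f, which is [J_z, F].
      rw [← hf, ← inner_kreinRHS, ← hj, inner_connectingOpRev,
        ← fourierEquiv_symm_eq b ha ha0 hf.symm]
      change inner ℂ ((fourierEquiv b ha ha0 T).symm _) ((fourierEquiv b ha ha0 T).symm _) = _
      rw [LinearEquiv.symm_apply_apply]
    · rw [coe_fourierEquiv, hJ, hsum, deBrangesKernel, ← sum_conj_jacobiPhi_mul b ha T z x,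
        mul_div_cancel_left₀]
      exact mul_ne_zero (mul_ne_zero two_ne_zero Complex.I_ne_zero) (sub_ne_zero.2 hx.symm)
    · rw [coe_fourierEquiv, hJ, hsum]
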